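/- Conventions. Let $E$ be a Dedekind complete Riesz space with weak order unit $e$ (that is, $e\ge 0$ and $|x|\wedge e=0$ implies $x=0$). A sequence $(f_n)$ in $E$ converges to $f$ in order if there is a sequence $p_n\downarrow 0$ in $E$ with $|f_n-f|\le p_n$ for all $n$. A band projection on $E$ is the projection $P$ of $E$ onto a band $B$ along its disjoint complement $B^d$. A sequence $(R_n)_{n\ge 0}$ of band projections is of density zero if $\frac1n\sum_{k=0}^{n-1}R_k\to 0$ in order in the Riesz space of order bounded operators on $E$. A conditional expectation operator on $E$ is a positive order continuous linear projection $T$ on $E$ whose range is a Dedekind complete Riesz subspace of $E$ and which maps weak order units to weak order units. $(E,T,S,e)$ is a conditional expectation preserving system if $T$ is a conditional expectation operator on $E$ with $Te=e$, and $S$ is an order continuous Riesz homomorphism on $E$ with $Se=e$ and $TSPe=TPe$ for each band projection $P$ on $E$. Let $E_e=\{f\in E: |f|\le ke \text{ for some } k\ge 0\}$, and let $\cdot$ be the multiplication that makes $E_e$ an $f$-algebra with unit $e$. It satisfies $Pe\cdot Qe=PQe$ for all band projections $P,Q$. For band projections $P,Q$ write $(S^kP)Qe:=S^k(Pe)\cdot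 Qe$. Theorem. Let $(E,T,S,e)$ be a conditional expectation preserving system. The following statements are equivalent. (1) $(E,T,S,e)$ is weakly mixing, that is, for all band projections $P$ and $Q$ on $E$, $$\frac1n\sum_{k=0}^{n-1}\bigl|T\bigl((S^kP)Qe\bigr)-TPe\cdot TQe\bigr|\to 0\quad\text{in order, as } n\to\infty.$$ (2) For all $f,g\in E_e$, $$\frac1n\sum_{k=0}^{n-1}\bigl|T\bigl((S^kf)\cdot g\bigr)-Tf\cdot Tg\bigr|\to 0\quad\text{in order, as } n\to\infty.$$ (3) For each pair of band projections $P$ and $Q$ on $E$ there is a sequence $(R_n)_{n\ge 0}$ of band projections on $E$ of density zero such that $$(I-R_n)\bigl|T\bigl((S^nP)Qe\bigr)-TPe\cdot TQe\bigr|\to 0\quad\text{in order, as } n\to\infty.$$ -/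

import Mathlib

/-! A Dedekind complete Riesz space is a real vector space `E` with a conditionally complete lattice
order that is compatible with addition and with multiplication by nonnegative scalars. -/

namespace RieszMixing

section Basic

variable {E : Type*} [AddCommGroup E] [ConditionallyCompleteLattice E] [Module ℝ E]

/-- Order convergence of the sequence `f` to `l`: there is a sequence `p` decreasing to `0`
(antitone with infimum `0`) such that `|f n - l| ≤ p n` for all `n`. -/
def OrderTendsto (f : ℕ → E) (l : E) : Prop :=
  ∃ p : ℕ → E, Antitone p ∧ IsGLB (Set.range p) 0 ∧ ∀ n, |f n - l| ≤ p n

/-- Weak order units: `e ≥ 0` and only `0` is disjoint from `e`. -/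
def IsWeakOrderUnit (e : E) : Prop :=
  0 ≤ e ∧ ∀ x : E, |x| ⊓ e = 0 → x = 0

/-- Bands: solid subspaces which contain the supremum of each of their subsets that has a
supremum in `E`. -/
structure IsBand (B : Submodule ℝ E) : Prop where
  solid : ∀ x y : E, y ∈ B → |x| ≤ |y| → x ∈ B
  sup_mem : ∀ (A : Set E) (s : E), A ⊆ B → IsLUB A s → s ∈ B

/-- Band projections: `P` is the projection onto a band `B` along the disjoint complement of `B`. -/
def IsBandProjection (P : E →ₗ[ℝ] E) : Prop :=
  ∃ B : Submodule ℝ E, IsBand B ∧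
    ∀ x : E, P x ∈ B ∧ ∀ y ∈ B, |x - P x| ⊓ |y| = 0

/-- The order of operators: `A ≤ B` if and only if `A x ≤ B x` for all `x ≥ 0`. -/
def OpLE (A B : E →ₗ[ℝ] E) : Prop :=
  ∀ x : E, 0 ≤ x → A x ≤ B x

/-- Order convergence to `0` of a sequence of operators, with respect to `OpLE`: there is a
sequence `U` of operators, decreasing with infimum `0`, such that `-U n ≤ A n ≤ U n` for all `n`.
Every operator `A n`, `U n` as here, and every lower bound `W` of the `U n`, is a difference of
positive operators, so that this is order convergence in the Riesz space of order bounded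
operators on `E`. -/
def OpOrderTendstoZero (A : ℕ → E →ₗ[ℝ] E) : Prop :=
  ∃ U : ℕ → E →ₗ[ℝ] E,
    (∀ m n, m ≤ n → OpLE (U n) (U m)) ∧
    (∀ n, OpLE 0 (U n)) ∧
    (∀ W : E →ₗ[ℝ] E, (∀ n, OpLE W (U n)) → OpLE W 0) ∧
    ∀ n, OpLE (-(U n)) (A n) ∧ OpLE (A n) (U n)

/-- A sequence of operators (band projections in all uses) of density zero. -/
def IsDensityZero (P : ℕ → E →ₗ[ℝ] E) : Prop :=
  OpOrderTendstoZero fun n => (n : ℝ)⁻¹ • ∑ k ∈ Finset.range n, P k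

/-- Order continuity of a positive operator: it maps each nonempty downward directed set with
infimum `0` to a set with infimum `0`. -/
def IsOrderContinuous (T : E →ₗ[ℝ] E) : Prop :=
  ∀ D : Set E, D.Nonempty → DirectedOn (· ≥ ·) D → IsGLB D 0 → IsGLB (T '' D) 0

/-- Conditional expectation operators: positive order continuous projections, the range of which
is a Dedekind complete Riesz subspace, and which map weak order units to weak order units. -/
structure IsConditionalExpectation (T : E →ₗ[ℝ] E) : Prop where
  positive : ∀ x : E, 0 ≤ x → 0 ≤ T x
  orderContinuous : IsOrderContinuous T
  idempotent : ∀ x : E, T (T x) = T x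
  range_sup : ∀ x ∈ LinearMap.range T, ∀ y ∈ LinearMap.range T, x ⊔ y ∈ LinearMap.range T
  range_complete : ∀ A : Set (LinearMap.range T), A.Nonempty → BddAbove A → ∃ s, IsLUB A s
  map_weakOrderUnit : ∀ u : E, IsWeakOrderUnit u → IsWeakOrderUnit (T u)

/-- Conditional expectation preserving systems `(E, T, S, e)`. -/
structure IsConditionalExpectationPreservingSystem (T S : E →ₗ[ℝ] E) (e : E) : Prop where
  unit : IsWeakOrderUnit e
  condExp : IsConditionalExpectation T
  T_unit : T e = e
  S_sup : ∀ x y : E, S (x ⊔ y) = S x ⊔ S y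
  S_inf : ∀ x y : E, S (x ⊓ y) = S x ⊓ S y
  S_orderContinuous : IsOrderContinuous S
  S_unit : S e = e
  preserving : ∀ P : E →ₗ[ℝ] E, IsBandProjection P → T (S (P e)) = T (P e)

/-- The set `E_e` of the `e`-bounded elements of `E`. -/
def eBounded (e : E) : Set E :=
  {f | ∃ k : ℝ, 0 ≤ k ∧ |f| ≤ k • e}

/-- The square of `f ∈ E_e` in the `f`-algebra `E_e` with unit `e`: the supremum of
`2 a f - a ^ 2 e` over all real `a` (that is, `f ^ 2` is the least element `s` with
`s - 2 a f + a ^ 2 e ≥ 0` for all real `a`). -/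
noncomputable def eSq (e f : E) : E :=
  ⨆ a : ℝ, ((2 * a) • f - a ^ 2 • e)

/-- The `f`-algebra multiplication of `E_e` with unit `e`, by polarization
`f g = ((f + g) ^ 2 - (f - g) ^ 2) / 4`; used for `f, g ∈ E_e` only. The lemmas below show that it
is the `f`-algebra multiplication. -/
noncomputable def eMul (e f g : E) : E :=
  (1 / 4 : ℝ) • (eSq e (f + g) - eSq e (f - g))

/-- Weak mixing. The element `(S ^ k P) Q e` is the product `(S ^ k (P e)) · (Q e)`: here `S ^ k P`
stands for the band projection that corresponds to the component `S ^ k (P e)` of `e`. -/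
def IsWeaklyMixing (T S : E →ₗ[ℝ] E) (e : E) : Prop :=
  ∀ P Q : E →ₗ[ℝ] E, IsBandProjection P → IsBandProjection Q →
    OrderTendsto (fun n : ℕ => (n : ℝ)⁻¹ • ∑ k ∈ Finset.range n,
      |T (eMul e ((S ^ k) (P e)) (Q e)) - eMul e (T (P e)) (T (Q e))|) 0

end Basic

/-! The multiplication `eMul e` makes `E_e` a commutative `f`-algebra with unit `e`: it is commutative,
associative, bilinear, positive, has unit `e`, and multiplication by a positive element preserves
disjointness. There is only one such multiplication. -/

section Product

set_option linter.unusedSectionVars false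

variable {E : Type*} [AddCommGroup E] [ConditionallyCompleteLattice E] [IsOrderedAddMonoid E]
  [Module ℝ E] [PosSMulMono ℝ E] {e f g h : E}

theorem rsmul_le (he : 0 ≤ e) {a b : ℝ} (hab : a ≤ b) : a • e ≤ b • e := by
  have := smul_nonneg (sub_nonneg.2 hab) he
  rwa [sub_smul, sub_nonneg] at this

theorem archimedean {y z : E} (hyz : ∀ n : ℕ, (n : ℝ) • y ≤ z) : y ≤ 0 := by
  have hb : BddAbove (Set.range fun n : ℕ => (n : ℝ) • y) := ⟨z, by rintro _ ⟨n, rfl⟩; exact hyz n⟩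
  have h1 : (⨆ n : ℕ, (n : ℝ) • y) ≤ (⨆ n : ℕ, (n : ℝ) • y) - y := by
    refine ciSup_le fun n => ?_
    have := le_ciSup hb (n + 1)
    simp only [Nat.cast_add, Nat.cast_one, add_smul, one_smul] at this
    exact le_sub_iff_add_le.2 this
  simpa using h1

theorem abs_smul_le (a : ℝ) (x : E) : a • x ≤ |a| • |x| := by
  rcases le_total 0 a with ha | ha
  · rw [abs_of_nonneg ha]; exact smul_le_smul_of_nonneg_left (le_abs_self x) ha
  · rw [abs_of_nonpos ha]
    have := smul_le_smul_of_nonneg_left (neg_le_abs x) (neg_nonneg.2 ha)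
    simpa using this

theorem abs_smul_eq (a : ℝ) (x : E) : |a • x| ≤ |a| • |x| := by
  refine abs_le'.2 ⟨abs_smul_le a x, ?_⟩
  have := abs_smul_le (-a) x
  simpa using this

theorem eBounded_add (hf : f ∈ eBounded e) (hg : g ∈ eBounded e) : f + g ∈ eBounded e := by
  obtain ⟨k, hk, hf⟩ := hf
  obtain ⟨l, hl, hg⟩ := hg
  exact ⟨k + l, by positivity, (abs_add_le f g).trans (by rw [add_smul]; exact add_le_add hf hg)⟩

theorem eBounded_smul (a : ℝ) (hf : f ∈ eBounded e) : a • f ∈ eBounded e := by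
  obtain ⟨k, hk, hf⟩ := hf
  refine ⟨|a| * k, by positivity, (abs_smul_eq a f).trans ?_⟩
  rw [mul_smul]
  exact smul_le_smul_of_nonneg_left hf (abs_nonneg a)

theorem eBounded_neg (hf : f ∈ eBounded e) : -f ∈ eBounded e := by
  simpa [eBounded] using hf

theorem eBounded_sub (hf : f ∈ eBounded e) (hg : g ∈ eBounded e) : f - g ∈ eBounded e := by
  rw [sub_eq_add_neg]; exact eBounded_add hf (eBounded_neg hg)

theorem eBounded_unit (he : 0 ≤ e) : e ∈ eBounded e :=
  ⟨1, zero_le_one, by rw [abs_of_nonneg he, one_smul]⟩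

theorem eSq_term_le (he : 0 ≤ e) {k : ℝ} (hf : |f| ≤ k • e) (a : ℝ) :
    (2 * a) • f - a ^ 2 • e ≤ k ^ 2 • e := by
  rw [sub_le_iff_le_add, ← add_smul]
  refine (abs_smul_le _ f).trans ((smul_le_smul_of_nonneg_left hf (abs_nonneg _)).trans ?_)
  rw [smul_smul]
  refine rsmul_le he ?_
  rw [abs_mul, abs_two]
  nlinarith [sq_nonneg (k - |a|), sq_abs a]

theorem isLUB_eSq (he : 0 ≤ e) (hf : f ∈ eBounded e) :
    IsLUB (Set.range fun a : ℝ => (2 * a) • f - a ^ 2 • e) (eSq e f) := by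
  obtain ⟨k, -, hf⟩ := hf
  exact isLUB_ciSup ⟨k ^ 2 • e, by rintro _ ⟨a, rfl⟩; exact eSq_term_le he hf a⟩

theorem eSq_le_iff (he : 0 ≤ e) (hf : f ∈ eBounded e) {s : E} :
    eSq e f ≤ s ↔ ∀ a : ℝ, (2 * a) • f - a ^ 2 • e ≤ s := by
  rw [isLUB_le_iff (isLUB_eSq he hf)]
  simp [upperBounds]

theorem le_eSq (he : 0 ≤ e) (hf : f ∈ eBounded e) (a : ℝ) :
    (2 * a) • f - a ^ 2 • e ≤ eSq e f :=
  (isLUB_eSq he hf).1 ⟨a, rfl⟩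

theorem eSq_nonneg (he : 0 ≤ e) (hf : f ∈ eBounded e) : 0 ≤ eSq e f := by
  simpa using le_eSq he hf 0

theorem eSq_le_smul (he : 0 ≤ e) {k : ℝ} (hk : 0 ≤ k) (hf : |f| ≤ k • e) :
    eSq e f ≤ k ^ 2 • e :=
  (eSq_le_iff he ⟨k, hk, hf⟩).2 (eSq_term_le he hf)

theorem eSq_neg (he : 0 ≤ e) (hf : f ∈ eBounded e) : eSq e (-f) = eSq e f := by
  have key : ∀ x : E, x ∈ eBounded e → eSq e (-x) ≤ eSq e x := fun x hx => by
    refine (eSq_le_iff he (eBounded_neg hx)).2 fun a => ?_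
    have := le_eSq he hx (-a)
    convert this using 2
    · module
    · ring_nf
  exact le_antisymm (key f hf) (by simpa using key (-f) (eBounded_neg hf))

theorem eSq_mono_abs (he : 0 ≤ e) (hf : f ∈ eBounded e) (hg : g ∈ eBounded e) (hfg : |f| ≤ g) :
    eSq e f ≤ eSq e g := by
  refine (eSq_le_iff he hf).2 fun a => le_trans ?_ (le_eSq he hg |a|)
  rw [sq_abs]
  refine sub_le_sub_right ((abs_smul_le _ f).trans ?_) _
  rw [abs_mul, abs_two]
  exact smul_le_smul_of_nonneg_left hfg (by positivity)

theorem eSq_parallelogram (he : 0 ≤ e) (hf : f ∈ eBounded e) (hg : g ∈ eBounded e) :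
    eSq e (f + g) + eSq e (f - g) = (2 : ℝ) • eSq e f + (2 : ℝ) • eSq e g := by
  have two : ∀ x y z : E, (∀ a b : ℝ, x ∈ eBounded e → y ∈ eBounded e →
      ((2 * a) • x - a ^ 2 • e) + ((2 * b) • y - b ^ 2 • e) ≤ z) → x ∈ eBounded e →
      y ∈ eBounded e → eSq e x + eSq e y ≤ z := fun x y z H hx hy => by
    rw [← le_sub_iff_add_le]
    refine (eSq_le_iff he hx).2 fun a => ?_
    rw [le_sub_comm]
    refine (eSq_le_iff he hy).2 fun b => ?_
    rw [le_sub_iff_add_le, add_comm]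
    exact H a b hx hy
  have hs := eBounded_add hf hg
  have hd := eBounded_sub hf hg
  refine le_antisymm (two _ _ _ (fun a b _ _ => ?_) hs hd) ?_
  · have h1 := smul_le_smul_of_nonneg_left (le_eSq he hf ((a + b) / 2)) (zero_le_two (α := ℝ))
    have h2 := smul_le_smul_of_nonneg_left (le_eSq he hg ((a - b) / 2)) (zero_le_two (α := ℝ))
    refine le_trans (le_of_eq ?_) (add_le_add h1 h2)
    module
  · have : eSq e f + eSq e g ≤ (1 / 2 : ℝ) • (eSq e (f + g) + eSq e (f - g)) := by
      refine two _ _ _ (fun a b _ _ => ?_) hf hg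
      have h1 := add_le_add (le_eSq he hs (a + b)) (le_eSq he hd (a - b))
      refine le_trans (le_of_eq ?_)
        (smul_le_smul_of_nonneg_left h1 (by norm_num : (0 : ℝ) ≤ 1 / 2))
      module
    have := smul_le_smul_of_nonneg_left this (zero_le_two (α := ℝ))
    rwa [smul_smul, smul_add, mul_one_div, div_self two_ne_zero, one_smul] at this

theorem eMul_comm (he : 0 ≤ e) (hf : f ∈ eBounded e) (hg : g ∈ eBounded e) :
    eMul e f g = eMul e g f := by
  rw [eMul, eMul, add_comm g f, ← neg_sub f g, eSq_neg he (eBounded_sub hf hg)]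

theorem eSq_zero (he : 0 ≤ e) : eSq e (0 : E) = 0 := by
  refine le_antisymm ?_ (eSq_nonneg he ⟨0, le_rfl, by simp⟩)
  simpa using eSq_le_smul he (le_refl (0 : ℝ)) (f := (0 : E)) (by simp)

theorem eMul_add_left (he : 0 ≤ e) (hf : f ∈ eBounded e) (hg : g ∈ eBounded e)
    (hh : h ∈ eBounded e) : eMul e (f + g) h = eMul e f h + eMul e g h := by
  have p1 := eSq_parallelogram he (eBounded_add hf hh) hg
  have p2 := eSq_parallelogram he (eBounded_sub hf hh) hg
  have p3 := eSq_parallelogram he (eBounded_add hg hh) hf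
  have p4 := eSq_parallelogram he (eBounded_sub hg hh) hf
  rw [show f + h + g = f + g + h by abel, show f + h - g = f - g + h by abel] at p1
  rw [show f - h + g = f + g - h by abel, show f - h - g = f - g - h by abel] at p2
  rw [show g + h + f = f + g + h by abel, show g + h - f = -(f - g - h) by abel,
    eSq_neg he (eBounded_sub (eBounded_sub hf hg) hh)] at p3
  rw [show g - h + f = f + g - h by abel, show g - h - f = -(f - g + h) by abel,
    eSq_neg he (eBounded_add (eBounded_sub hf hg) hh)] at p4
  simp only [eMul]
  have := congrArg₂ (· + ·) (congrArg₂ (· - ·) p1 p2) (congrArg₂ (· - ·) p3 p4)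
  have h8 := congrArg (fun x : E => (1 / 8 : ℝ) • x) this
  calc _ = (1 / 8 : ℝ) • (eSq e (f + g + h) + eSq e (f - g + h)
        - (eSq e (f + g - h) + eSq e (f - g - h)) +
        (eSq e (f + g + h) + eSq e (f - g - h) - (eSq e (f + g - h) + eSq e (f - g + h)))) := by
        module
    _ = _ := h8
    _ = _ := by module

theorem eMul_nonneg (he : 0 ≤ e) (hf : f ∈ eBounded e) (hg : g ∈ eBounded e) (hf0 : 0 ≤ f)
    (hg0 : 0 ≤ g) : 0 ≤ eMul e f g := by
  refine smul_nonneg (by norm_num) (sub_nonneg.2 (eSq_mono_abs he (eBounded_sub hf hg)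
    (eBounded_add hf hg) (abs_le'.2 ⟨?_, ?_⟩)))
  · exact (sub_le_self f hg0).trans (le_add_of_nonneg_right hg0)
  · rw [neg_sub]; exact (sub_le_self g hf0).trans (le_add_of_nonneg_left hf0)

theorem eMul_unit (he : 0 ≤ e) (hf : f ∈ eBounded e) : eMul e f e = f := by
  have key : ∀ x : E, x ∈ eBounded e → eSq e x + (2 : ℝ) • x + e ≤ eSq e (x + e) ∧
      eSq e (x + e) ≤ eSq e x + (2 : ℝ) • x + e := fun x hx => by
    have hxe := eBounded_add hx (eBounded_unit he)
    constructor
    · rw [add_assoc, ← le_sub_iff_add_le]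
      refine (eSq_le_iff he hx).2 fun a => ?_
      rw [le_sub_iff_add_le]
      refine le_trans (le_of_eq ?_) (le_eSq he hxe (a + 1))
      module
    · refine (eSq_le_iff he hxe).2 fun a => ?_
      have := add_le_add_left (le_eSq he hx (a - 1)) ((2 : ℝ) • x + e)
      rw [add_assoc]
      refine le_trans (le_of_eq ?_) this
      module
  have k1 := le_antisymm (key f hf).1 (key f hf).2
  have k2 := le_antisymm (key _ (eBounded_neg hf)).1 (key _ (eBounded_neg hf)).2
  rw [eSq_neg he hf, show -f + e = -(f - e) by abel,
    eSq_neg he (eBounded_sub hf (eBounded_unit he))] at k2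
  rw [eMul, ← k1, ← k2]
  module

theorem eMul_mem (he : 0 ≤ e) (hf : f ∈ eBounded e) (hg : g ∈ eBounded e) :
    eMul e f g ∈ eBounded e := by
  have sq : ∀ x : E, x ∈ eBounded e → eSq e x ∈ eBounded e := fun x hx => by
    obtain ⟨k, hk, hx'⟩ := id hx
    exact ⟨k ^ 2, by positivity, by
      rw [abs_of_nonneg (eSq_nonneg he hx)]; exact eSq_le_smul he hk hx'⟩
  exact eBounded_smul _ (eBounded_sub (sq _ (eBounded_add hf hg)) (sq _ (eBounded_sub hf hg)))

theorem eMul_smul_left (he : 0 ≤ e) (a : ℝ) (hf : f ∈ eBounded e) (hg : g ∈ eBounded e) :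
    eMul e (a • f) g = a • eMul e f g := by
  obtain ⟨k, hk, hfk⟩ := id hf
  obtain ⟨l, hl, hgl⟩ := id hg
  -- the defect of homogeneity is additive in `a`, vanishes at `1`, and is bounded on `[0, 1]`
  let F : ℝ →+ E :=
    { toFun := fun a => eMul e (a • f) g - a • eMul e f g
      map_zero' := by
        simp [eMul, eSq_neg he hg]
      map_add' := fun a b => by
        rw [add_smul, add_smul, eMul_add_left he (eBounded_smul a hf) (eBounded_smul b hf) hg]
        abel }
  have F1 : F 1 = 0 := by simp [F]
  have Fint : ∀ n : ℤ, F n = 0 := fun n => by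
    have := map_zsmul F n (1 : ℝ)
    rw [F1, smul_zero] at this
    simpa using this
  obtain ⟨M, hM0, hM⟩ := eMul_mem he hf hg
  have bound : ∀ b : ℝ, 0 ≤ b → b ≤ 1 → F b ≤ ((k + l) ^ 2 + M) • e := fun b hb0 hb1 => by
    have h1 : |b • f + g| ≤ (k + l) • e := by
      refine (abs_add_le _ _).trans ?_
      rw [add_smul]
      refine add_le_add ((abs_smul_eq b f).trans ?_) hgl
      rw [abs_of_nonneg hb0]
      refine (smul_le_smul_of_nonneg_left hfk hb0).trans ?_
      rw [smul_smul]
      exact rsmul_le he (by nlinarith)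
    have h2 := eSq_le_smul he (by positivity : 0 ≤ k + l) h1
    have h3 := eSq_nonneg he (eBounded_sub (eBounded_smul b hf) hg)
    have h4 : eMul e (b • f) g ≤ (k + l) ^ 2 • e := by
      have := smul_le_smul_of_nonneg_left ((sub_le_self _ h3).trans h2)
        (by norm_num : (0 : ℝ) ≤ 1 / 4)
      refine this.trans ?_
      rw [smul_smul]
      exact rsmul_le he (by nlinarith [sq_nonneg (k + l)])
    have h5 : -(b • eMul e f g) ≤ M • e := by
      have h6 := abs_smul_le (-b) (eMul e f g)
      rw [neg_smul, abs_neg, abs_of_nonneg hb0] at h6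
      refine h6.trans ((smul_le_smul_of_nonneg_left hM hb0).trans ?_)
      rw [smul_smul]
      exact rsmul_le he (by nlinarith)
    calc F b = eMul e (b • f) g + -(b • eMul e f g) := sub_eq_add_neg _ _
      _ ≤ _ := by rw [add_smul]; exact add_le_add h4 h5
  have le0 : ∀ b : ℝ, F b ≤ 0 := fun b => by
    refine archimedean (z := ((k + l) ^ 2 + M) • e) fun n => ?_
    have h1 : (n : ℝ) • F b = F (Int.fract (n * b)) := by
      rw [Int.fract, map_sub, Fint, sub_zero, ← nsmul_eq_mul, map_nsmul, Nat.cast_smul_eq_nsmul]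
    rw [h1]
    exact bound _ (Int.fract_nonneg _) (Int.fract_lt_one _).le
  have h1 : F a = 0 := by
    refine le_antisymm (le0 a) ?_
    have := le0 (-a)
    rwa [map_neg, neg_nonpos] at this
  exact sub_eq_zero.1 h1

theorem smul_inf_le (a : ℝ) (ha : 0 < a) (hfg : f ⊓ g = 0) : a • f ⊓ a • g ≤ 0 := by
  have h1 : a⁻¹ • (a • f ⊓ a • g) ≤ f ⊓ g := by
    refine le_inf ?_ ?_
    · have := smul_le_smul_of_nonneg_left (inf_le_left : a • f ⊓ a • g ≤ _) (inv_nonneg.2 ha.le)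
      rwa [smul_smul, inv_mul_cancel₀ ha.ne', one_smul] at this
    · have := smul_le_smul_of_nonneg_left (inf_le_right : a • f ⊓ a • g ≤ _) (inv_nonneg.2 ha.le)
      rwa [smul_smul, inv_mul_cancel₀ ha.ne', one_smul] at this
  rw [hfg] at h1
  have := smul_le_smul_of_nonneg_left h1 ha.le
  rwa [smul_smul, mul_inv_cancel₀ ha.ne', one_smul, smul_zero] at this

theorem eBounded_abs (hf : f ∈ eBounded e) : |f| ∈ eBounded e := by
  simpa [eBounded] using hf

theorem eMul_sub_left (he : 0 ≤ e) (hf : f ∈ eBounded e) (hg : g ∈ eBounded e)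
    (hh : h ∈ eBounded e) : eMul e (f - g) h = eMul e f h - eMul e g h := by
  have := eMul_add_left he (eBounded_sub hf hg) hg hh
  rw [sub_add_cancel] at this
  exact eq_sub_of_add_eq this.symm

theorem abs_eMul_le (he : 0 ≤ e) (hf : f ∈ eBounded e) {l : ℝ} (hl : 0 ≤ l) (hg : |g| ≤ l • e) :
    |eMul e f g| ≤ l • |f| := by
  have hgm : g ∈ eBounded e := ⟨l, hl, hg⟩
  have hga := eBounded_abs hgm
  have le1 : ∀ x : E, x ∈ eBounded e → eMul e x g ≤ eMul e |x| |g| := fun x hx => by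
    have hxa := eBounded_abs hx
    have p1 := eMul_nonneg he (eBounded_sub hxa hx) (eBounded_add hga hgm)
      (sub_nonneg.2 (le_abs_self x)) (by simpa using sub_nonneg.2 (neg_le_abs g))
    have p2 := eMul_nonneg he (eBounded_add hxa hx) (eBounded_sub hga hgm)
      (by simpa using sub_nonneg.2 (neg_le_abs x)) (sub_nonneg.2 (le_abs_self g))
    have e1 : ∀ y : E, y ∈ eBounded e → eMul e y (|g| + g) = eMul e y |g| + eMul e y g :=
      fun y hy => by
        rw [eMul_comm he hy (eBounded_add hga hgm), eMul_add_left he hga hgm hy,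
          eMul_comm he hga hy, eMul_comm he hgm hy]
    have e2 : ∀ y : E, y ∈ eBounded e → eMul e y (|g| - g) = eMul e y |g| - eMul e y g :=
      fun y hy => by
        rw [eMul_comm he hy (eBounded_sub hga hgm), eMul_sub_left he hga hgm hy,
          eMul_comm he hga hy, eMul_comm he hgm hy]
    rw [e1 _ (eBounded_sub hxa hx), eMul_sub_left he hxa hx hga, eMul_sub_left he hxa hx hgm] at p1
    rw [e2 _ (eBounded_add hxa hx), eMul_add_left he hxa hx hga, eMul_add_left he hxa hx hgm] at p2
    have p3 := smul_nonneg (by norm_num : (0 : ℝ) ≤ 1 / 2) (add_nonneg p1 p2)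
    rw [← sub_nonneg]
    convert p3 using 1
    module
  have le2 : eMul e |f| |g| ≤ l • |f| := by
    have hfa := eBounded_abs hf
    have hle := eBounded_smul l (eBounded_unit he)
    have := eMul_nonneg he (eBounded_sub hle hga) hfa (sub_nonneg.2 hg) (abs_nonneg f)
    rw [eMul_sub_left he hle hga hfa, eMul_smul_left he l (eBounded_unit he) hfa,
      eMul_comm he (eBounded_unit he) hfa, eMul_unit he hfa, sub_nonneg] at this
    rwa [eMul_comm he hfa hga]
  refine abs_le'.2 ⟨(le1 f hf).trans le2, ?_⟩
  have := (le1 (-f) (eBounded_neg hf)).trans_eq (by rw [abs_neg])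
  have h1 := eMul_smul_left he (-1) hf hgm
  rw [neg_one_smul, neg_one_smul] at h1
  rw [← h1]
  exact this.trans le2

/-- Multiplication by a positive element preserves disjointness. -/
theorem eMul_inf_eq_zero (he : 0 ≤ e) (hf : f ∈ eBounded e) (hh : h ∈ eBounded e) (hh0 : 0 ≤ h)
    (hfg : f ⊓ g = 0) : eMul e f h ⊓ g = 0 := by
  have hf0 : 0 ≤ f := hfg ▸ inf_le_left
  have hg0 : 0 ≤ g := hfg ▸ inf_le_right
  obtain ⟨l, hl, hhl⟩ := id hh
  have h1 := (le_abs_self _).trans (abs_eMul_le he hf hl hhl)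
  rw [abs_of_nonneg hf0] at h1
  refine le_antisymm ?_ (le_inf (eMul_nonneg he hf hh hf0 hh0) hg0)
  refine le_trans (inf_le_inf ?_ ?_) (smul_inf_le (l + 1) (by positivity) hfg)
  · rw [add_smul, one_smul]; exact h1.trans (le_add_of_nonneg_right hf0)
  · rw [add_smul, one_smul]; exact le_add_of_nonneg_left (smul_nonneg hl hg0)

theorem eMul_eq_zero (he : 0 ≤ e) (hf : f ∈ eBounded e) (hg : g ∈ eBounded e)
    (hfg : f ⊓ g = 0) : eMul e f g = 0 := by
  have hf0 : 0 ≤ f := hfg ▸ inf_le_left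
  have hg0 : 0 ≤ g := hfg ▸ inf_le_right
  have h1 := eMul_inf_eq_zero he hf hg hg0 hfg
  have h2 := eMul_inf_eq_zero he hg (eMul_mem he hf hg) (eMul_nonneg he hf hg hf0 hg0)
    (by rwa [inf_comm])
  obtain ⟨l, hl, hfl⟩ := id hf
  have h3 := (le_abs_self _).trans (abs_eMul_le he hg hl hfl)
  rw [abs_of_nonneg hg0, ← eMul_comm he hf hg] at h3
  have h4 := eMul_nonneg he hf hg hf0 hg0
  refine le_antisymm ?_ h4
  refine le_trans (le_inf ?_ ?_) (smul_inf_le (l + 1) (by positivity) h1)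
  · rw [add_smul, one_smul]; exact le_add_of_nonneg_left (smul_nonneg hl h4)
  · rw [add_smul, one_smul]; exact h3.trans (le_add_of_nonneg_right hg0)

theorem le_zero_of_le_abs_sub (he : 0 ≤ e) (hf : f ∈ eBounded e)
    (hy : ∀ a : ℝ, g ≤ |f - a • e|) : g ≤ 0 := by
  obtain ⟨k, hk, hfk⟩ := hf
  have key : ∀ d : ℝ, 0 < d → g ≤ d • e := fun d hd => by
    have ind : ∀ i : ℕ, g ≤ d • e + ((f - (i * d - k) • e) ⊔ 0) := fun i => by
      induction i with
      | zero =>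
        refine (hy (-k)).trans ?_
        have h0 : 0 ≤ f - (-k) • e := by
          rw [neg_smul, sub_neg_eq_add, ← neg_le_iff_add_nonneg']
          exact (neg_le_abs f).trans hfk
        rw [abs_of_nonneg h0]
        simp only [Nat.cast_zero, zero_mul, zero_sub]
        exact le_add_of_nonneg_of_le (smul_nonneg hd.le he) le_sup_left
      | succ i ih =>
        set u := f - (i * d - k) • e with hu
        have hu' : f - ((i + 1 : ℕ) * d - k) • e = u - d • e := by
          rw [hu]; push_cast; module
        have h1 := hy ((i + 1 : ℕ) * d - k)
        rw [hu'] at h1 ⊢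
        have hde : 0 ≤ d • e := smul_nonneg hd.le he
        have A : g - d • e - ((u - d • e) ⊔ 0) ≤ u ⊔ 0 := by
          refine (sub_le_self _ le_sup_right).trans ?_
          rw [sub_le_iff_le_add']; exact ih
        have B : g - d • e - ((u - d • e) ⊔ 0) ≤ (-u) ⊔ 0 := by
          rw [sub_sub, sub_le_iff_le_add]
          refine h1.trans (abs_le'.2 ⟨?_, ?_⟩)
          · exact le_add_of_nonneg_of_le le_sup_right (le_add_of_nonneg_of_le hde le_sup_left)
          · rw [neg_sub, sub_eq_add_neg, add_comm]
            exact add_le_add le_sup_left (le_add_of_nonneg_right le_sup_right)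
        have C := le_inf A B
        have D : (u ⊔ 0) ⊓ (-u ⊔ 0) = 0 := by
          have := posPart_inf_negPart_eq_zero u
          simpa [posPart, negPart] using this
        rw [D, sub_sub, sub_nonpos] at C
        exact C
    obtain ⟨N, hN⟩ := exists_nat_ge (2 * k / d)
    have hN' : 2 * k ≤ N * d := (div_le_iff₀ hd).1 hN
    have h1 := ind N
    rwa [sup_of_le_right, add_zero] at h1
    rw [sub_nonpos]
    exact (le_abs_self f).trans (hfk.trans (rsmul_le he (by linarith)))
  refine archimedean (z := e) fun n => ?_
  rcases Nat.eq_zero_or_pos n with rfl | hn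
  · simpa using he
  · have hn' : (0 : ℝ) < n := by exact_mod_cast hn
    have := smul_le_smul_of_nonneg_left (key (n : ℝ)⁻¹ (inv_pos.2 hn')) hn'.le
    rwa [smul_smul, mul_inv_cancel₀ hn'.ne', one_smul] at this

theorem eMul_assoc (he : 0 ≤ e) (hf : f ∈ eBounded e) (hg : g ∈ eBounded e)
    (hh : h ∈ eBounded e) : eMul e (eMul e f g) h = eMul e f (eMul e g h) := by
  obtain ⟨l, hl, hgl⟩ := id hg
  obtain ⟨m, hm, hhm⟩ := id hh
  have hee := eBounded_unit he
  have hgh := eMul_mem he hg hh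
  have bd : ∀ x : E, x ∈ eBounded e →
      |eMul e (eMul e x g) h - eMul e x (eMul e g h)| ≤ (2 * (m * l)) • |x| := fun x hx => by
    have h1 := (abs_eMul_le he (eMul_mem he hx hg) hm hhm).trans
      (smul_le_smul_of_nonneg_left (abs_eMul_le he hx hl hgl) hm)
    have h2 : |eMul e g h| ≤ (m * l) • e := by
      rw [mul_smul]
      exact (abs_eMul_le he hg hm hhm).trans (smul_le_smul_of_nonneg_left hgl hm)
    have h3 := abs_eMul_le he hx (by positivity) h2
    rw [sub_eq_add_neg]
    refine (abs_add_le _ _).trans ?_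
    rw [abs_neg]
    refine (add_le_add h1 h3).trans_eq ?_
    module
  set c : ℝ := 2 * (m * l) with hc
  have hc0 : 0 ≤ c := by positivity
  have shift : ∀ a : ℝ, |eMul e (eMul e f g) h - eMul e f (eMul e g h)| ≤ c • |f - a • e| :=
    fun a => by
      have hae := eBounded_smul a hee
      have := bd _ (eBounded_sub hf hae)
      rw [eMul_sub_left he hf hae hg, eMul_sub_left he hf hae hgh,
        eMul_sub_left he (eMul_mem he hf hg) (eMul_mem he hae hg) hh,
        eMul_smul_left he a hee hg, eMul_smul_left he a hee hgh, eMul_comm he hee hg,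
        eMul_unit he hg, eMul_smul_left he a hg hh, eMul_comm he hee hgh, eMul_unit he hgh] at this
      rwa [sub_sub_sub_cancel_right] at this
  have h1 := le_zero_of_le_abs_sub he hf
    (g := (c + 1)⁻¹ • |eMul e (eMul e f g) h - eMul e f (eMul e g h)|) fun a => by
      have h2 : c • |f - a • e| ≤ (c + 1) • |f - a • e| := by
        rw [add_smul, one_smul]; exact le_add_of_nonneg_right (abs_nonneg _)
      have h3 := smul_le_smul_of_nonneg_left ((shift a).trans h2)
        (by positivity : 0 ≤ (c + 1)⁻¹)
      rwa [smul_smul (c + 1)⁻¹ (c + 1), inv_mul_cancel₀ (by positivity), one_smul] at h3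
  have h4 := smul_le_smul_of_nonneg_left h1 (by positivity : 0 ≤ c + 1)
  rw [smul_smul, mul_inv_cancel₀ (by positivity), one_smul, smul_zero] at h4
  have h5 := le_antisymm h4 (abs_nonneg _)
  rw [← sub_eq_zero]
  exact le_antisymm ((le_abs_self _).trans_eq h5) (by
    have := (neg_le_abs _).trans_eq h5
    rwa [neg_nonpos] at this)

theorem IsBandProjection.bounds {P : E →ₗ[ℝ] E} (hP : IsBandProjection P) {x : E} (hx : 0 ≤ x) :
    0 ≤ P x ∧ P x ≤ x := by
  obtain ⟨B, -, hB⟩ := hP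
  have hd := (hB x).2 _ (hB x).1
  have hs : P x + (x - P x) = x := by abel
  have h0 : 0 ≤ P x + (x - P x) := hs.symm ▸ hx
  have key : ∀ a b : E, |a| ⊓ |b| = 0 → 0 ≤ a + b → 0 ≤ a := fun a b hab h => by
    have h1 : (-a) ⊔ 0 ≤ |a| ⊓ |b| := by
      refine sup_le (le_inf (neg_le_abs a) ?_) (le_inf (abs_nonneg _) (abs_nonneg _))
      exact (neg_le_iff_add_nonneg'.2 h).trans (le_abs_self b)
    rw [hab] at h1
    exact neg_nonpos.1 (le_sup_left.trans h1)
  exact ⟨key _ _ (by rwa [inf_comm]) h0, sub_nonneg.1 (key _ _ hd (by rwa [add_comm]))⟩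

/-- On components of `e` the multiplication is `(P e) · (Q e) = P Q e`. -/
theorem eMul_bandProjection (he : 0 ≤ e) {P Q : E →ₗ[ℝ] E} (hP : IsBandProjection P)
    (hQ : IsBandProjection Q) : eMul e (P e) (Q e) = P (Q e) := by
  have mem : ∀ x : E, 0 ≤ x → x ≤ e → x ∈ eBounded e := fun x h0 h1 =>
    ⟨1, zero_le_one, by rwa [abs_of_nonneg h0, one_smul]⟩
  obtain ⟨p0, p1⟩ := hP.bounds he
  obtain ⟨q0, q1⟩ := hQ.bounds he
  obtain ⟨r0, r1⟩ := hP.bounds q0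
  have mP := mem _ p0 p1
  have mQ := mem _ q0 q1
  have mR := mem _ r0 (r1.trans q1)
  obtain ⟨B, -, hB⟩ := hP
  have d1 : (Q e - P (Q e)) ⊓ P e = 0 := by
    have := (hB (Q e)).2 _ (hB e).1
    rwa [abs_of_nonneg (sub_nonneg.2 r1), abs_of_nonneg p0] at this
  have d2 : (e - P e) ⊓ P (Q e) = 0 := by
    have := (hB e).2 _ (hB (Q e)).1
    rwa [abs_of_nonneg (sub_nonneg.2 p1), abs_of_nonneg r0] at this
  have h1 := eMul_eq_zero he (eBounded_sub mQ mR) mP d1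
  have h2 := eMul_eq_zero he (eBounded_sub (eBounded_unit he) mP) mR d2
  rw [eMul_sub_left he mQ mR mP, sub_eq_zero] at h1
  rw [eMul_sub_left he (eBounded_unit he) mP mR, eMul_comm he (eBounded_unit he) mR,
    eMul_unit he mR, sub_eq_zero] at h2
  rw [eMul_comm he mP mQ, h1, eMul_comm he mR mP, ← h2]

end Product

end RieszMixing

/-! Weak mixing in Riesz spaces.

Write `c_k(f, g) = T ((S ^ k f) · g) - T f · T g` for the correlations. They are bilinear on `E_e`
and bounded by a constant multiple of `e` that does not depend on `k`.

From components to `E_e`: the components `P e` span a subspace which is dense in `E_e` for the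
`e`-uniform norm (`exists_step_approximation`), so that by the uniform bound the averages of
`|c_k(f, g)|` are, up to `ε e`, dominated by order null sequences. This is done in one variable at
a time (`average_of_components`).

Averages and density zero: this is a Koopman–von Neumann lemma for sequences `0 ≤ a n ≤ C e`. Order
convergence has no uniform rate, so that the classical choice of thresholds along a sequence of
times is not available. Instead, if the averages of `a` are at most `p n`, which decreases to `0`,
then `R n` is the band projection onto the part where `a n ≥ √(p n)`
(`exists_densityZero_of_average`). The averages `D n` of the `R k` satisfy `D n √(p n) ≤ p n`, hence
`D n e ≤ √(p n)` (`map_unit_le_unitSqrt`). This bound at `e` becomes order convergence of the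
operators `D n` through a decreasing sequence of operators above them which are infima of dyadic
sums of band projections (`IsWeakOrderUnit.opOrderTendstoZero`). Conversely, order convergence of
operators is pointwise on the positive cone, because the infimum of a decreasing sequence of
positive operators is computed pointwise (`exists_operator_isGLB`). The averages of `a` are then
dominated by those of `R n (C e)` and of `(I - R n) (a n)` (`average_of_densityZero`).

Pointwise arguments are made rigorous by `le_zero_of_le_abs_sub`: an element below `|f - a e|` for
all real `a` is at most `0`. So an inequality may be checked "where `f` equals `a`", up to a
multiple of `|f - a e|`. -/

namespace RieszMixing

set_option linter.unusedSectionVars false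

variable {E : Type*} [AddCommGroup E] [ConditionallyCompleteLattice E] [IsOrderedAddMonoid E]
  [Module ℝ E] [PosSMulMono ℝ E]

/-! ### Positive operators -/

theorem map_mono_of_nonneg {A : E →ₗ[ℝ] E} (hA : ∀ x, 0 ≤ x → 0 ≤ A x) {x y : E} (hxy : x ≤ y) :
    A x ≤ A y := by
  have := hA (y - x) (sub_nonneg.2 hxy)
  rwa [map_sub, sub_nonneg] at this

theorem abs_map_le_map_abs {A : E →ₗ[ℝ] E} (hA : ∀ x, 0 ≤ x → 0 ≤ A x) (x : E) :
    |A x| ≤ A |x| := by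
  refine abs_le'.2 ⟨map_mono_of_nonneg hA (le_abs_self x), ?_⟩
  rw [← map_neg]
  exact map_mono_of_nonneg hA (neg_le_abs x)

theorem smul_le_iff_le_inv_smul {a : ℝ} (ha : 0 < a) {x y : E} : a • x ≤ y ↔ x ≤ a⁻¹ • y := by
  constructor <;> intro h
  · have := smul_le_smul_of_nonneg_left h (inv_nonneg.2 ha.le)
    rwa [smul_smul, inv_mul_cancel₀ ha.ne', one_smul] at this
  · have := smul_le_smul_of_nonneg_left h ha.le
    rwa [smul_smul, mul_inv_cancel₀ ha.ne', one_smul] at this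

theorem le_zero_of_le_smul {x u : E} (h : ∀ ε : ℝ, 0 < ε → x ≤ ε • u) : x ≤ 0 := by
  refine archimedean (z := |u|) fun n => ?_
  rcases Nat.eq_zero_or_pos n with rfl | hn
  · simp
  · have hn' : (0 : ℝ) < n := by exact_mod_cast hn
    rw [smul_le_iff_le_inv_smul hn']
    exact (h _ (inv_pos.2 hn')).trans
      (smul_le_smul_of_nonneg_left (le_abs_self u) (inv_nonneg.2 hn'.le))

/-! ### Bands and band projections -/

theorem add_inf_le_inf_add_inf {a b v : E} (ha : 0 ≤ a) (hb : 0 ≤ b) (hv : 0 ≤ v) :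
    (a + b) ⊓ v ≤ a ⊓ v + b ⊓ v := by
  rw [add_inf, inf_add, inf_add]
  refine le_inf (le_inf inf_le_left (inf_le_right.trans (le_add_of_nonneg_right hb)))
    (le_inf (inf_le_right.trans (le_add_of_nonneg_left ha))
      (inf_le_right.trans (le_add_of_nonneg_right hv)))

theorem inf_nonpos_of_forall_le_sup_sub {s v : E} (h : s ≤ s ⊔ v - v) : s ⊓ v ≤ 0 := by
  have h1 := inf_add_sup s v
  have h2 : s + v ≤ s ⊔ v := le_sub_iff_add_le.1 h
  rw [← h1] at h2
  simpa using h2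

/-- The disjoint complement of a single element. -/
def disjointComplement (v : E) : Submodule ℝ E where
  carrier := {x | |x| ⊓ |v| = 0}
  zero_mem' := by simp
  add_mem' := by
    intro x y hx hy
    refine le_antisymm ?_ (le_inf (abs_nonneg _) (abs_nonneg _))
    refine (inf_le_inf_right _ (abs_add_le x y)).trans ?_
    refine (add_inf_le_inf_add_inf (abs_nonneg x) (abs_nonneg y) (abs_nonneg v)).trans ?_
    rw [show |x| ⊓ |v| = 0 from hx, show |y| ⊓ |v| = 0 from hy, add_zero]
  smul_mem' := by
    intro c x hx
    refine le_antisymm ?_ (le_inf (abs_nonneg _) (abs_nonneg _))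
    refine le_trans (inf_le_inf ?_ ?_) (smul_inf_le (|c| + 1) (by positivity) hx)
    · refine (abs_smul_eq c x).trans ?_
      rw [add_smul, one_smul]
      exact le_add_of_nonneg_right (abs_nonneg x)
    · rw [add_smul, one_smul]
      exact le_add_of_nonneg_left (smul_nonneg (abs_nonneg c) (abs_nonneg v))

theorem mem_disjointComplement {v x : E} : x ∈ disjointComplement v ↔ |x| ⊓ |v| = 0 := Iff.rfl

theorem disjointComplement_solid {v x y : E} (hy : y ∈ disjointComplement v) (hxy : |x| ≤ |y|) :
    x ∈ disjointComplement v :=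
  le_antisymm ((inf_le_inf_right _ hxy).trans_eq hy) (le_inf (abs_nonneg _) (abs_nonneg _))

theorem abs_posPart_le (x : E) : |x⁺| ≤ |x| := by
  rw [abs_of_nonneg (posPart_nonneg x)]
  exact sup_le (le_abs_self x) (abs_nonneg x)

theorem abs_negPart_le (x : E) : |x⁻| ≤ |x| := by
  rw [abs_of_nonneg (negPart_nonneg x)]
  exact sup_le (neg_le_abs x) (abs_nonneg x)

theorem isBand_disjointComplement (v : E) : IsBand (disjointComplement v) where
  solid _ _ hy hxy := disjointComplement_solid hy hxy
  sup_mem := by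
    intro A s hA hs
    rcases A.eq_empty_or_nonempty with rfl | ⟨a, ha⟩
    · -- a supremum of the empty set is a least element, so the space is trivial
      have h0 : ∀ x, s ≤ x := fun x => hs.2 (by simp [upperBounds])
      have h1 := h0 0
      have h2 := h0 (s + s)
      rw [le_antisymm h1 (by simpa using h2)]
      exact Submodule.zero_mem _
    have hpos : s⁺ ∈ disjointComplement v := by
      rw [mem_disjointComplement, abs_of_nonneg (posPart_nonneg s)]
      refine le_antisymm (inf_nonpos_of_forall_le_sup_sub ?_)
        (le_inf (posPart_nonneg s) (abs_nonneg v))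
      refine sup_le (hs.2 fun y hy => ?_) (sub_nonneg.2 le_sup_right)
      have h1 : |y⁺| ⊓ |v| = 0 := disjointComplement_solid (hA hy) (abs_posPart_le y)
      rw [abs_of_nonneg (posPart_nonneg y)] at h1
      have h2 := inf_add_sup y⁺ |v|
      rw [h1, zero_add] at h2
      rw [le_sub_iff_add_le]
      refine (add_le_add_left (le_posPart y) _).trans (h2.symm.le.trans ?_)
      exact sup_le_sup_right (posPart_mono (hs.1 hy)) _
    have hneg : s⁻ ∈ disjointComplement v := by
      refine disjointComplement_solid (disjointComplement_solid (hA ha) (abs_negPart_le a)) ?_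
      rw [abs_of_nonneg (negPart_nonneg s), abs_of_nonneg (negPart_nonneg a)]
      exact negPart_anti (hs.1 ha)
    have := Submodule.sub_mem _ hpos hneg
    rwa [posPart_sub_negPart] at this

theorem isBand_top : IsBand (⊤ : Submodule ℝ E) := ⟨fun _ _ _ _ => trivial, fun _ _ _ _ => trivial⟩

theorem eq_zero_of_abs_inf_abs_self {x : E} (h : |x| ⊓ |x| = 0) : x = 0 := by
  rw [inf_idem] at h
  exact le_antisymm ((le_abs_self x).trans_eq h) (neg_nonpos.1 ((neg_le_abs x).trans_eq h))

/-- The Riesz decomposition of a positive element along a band: its component in the band is the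
largest element of the band below it. -/
theorem exists_band_decomposition_of_nonneg {B : Submodule ℝ E} (hB : IsBand B) {x : E}
    (hx : 0 ≤ x) : ∃ s ∈ B, ∀ y ∈ B, |x - s| ⊓ |y| = 0 := by
  set A : Set E := {y | y ∈ B ∧ 0 ≤ y ∧ y ≤ x} with hA
  have h0 : (0 : E) ∈ A := ⟨B.zero_mem, le_rfl, hx⟩
  have hs : IsLUB A (sSup A) := isLUB_csSup ⟨0, h0⟩ ⟨x, fun y hy => hy.2.2⟩
  have hsB : sSup A ∈ B := hB.sup_mem A _ (fun y hy => hy.1) hs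
  have hs0 : 0 ≤ sSup A := hs.1 h0
  have hsx : sSup A ≤ x := hs.2 fun y hy => hy.2.2
  refine ⟨sSup A, hsB, fun y hy => ?_⟩
  rw [abs_of_nonneg (sub_nonneg.2 hsx)]
  set z := (x - sSup A) ⊓ |y| with hz
  have hz0 : 0 ≤ z := le_inf (sub_nonneg.2 hsx) (abs_nonneg y)
  have hzB : z ∈ B := hB.solid z y hy (by rw [abs_of_nonneg hz0]; exact inf_le_right)
  have h1 : sSup A + z ≤ sSup A :=
    hs.1 ⟨B.add_mem hsB hzB, add_nonneg hs0 hz0, le_sub_iff_add_le'.1 inf_le_left⟩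
  exact le_antisymm (by simpa using h1) hz0

/-- In a Dedekind complete Riesz space every band is a projection band. -/
theorem exists_projection_onto_band {B : Submodule ℝ E} (hB : IsBand B) :
    ∃ P : E →ₗ[ℝ] E, ∀ x, P x ∈ B ∧ ∀ y ∈ B, |x - P x| ⊓ |y| = 0 := by
  let C : Submodule ℝ E := ⨅ y ∈ B, disjointComplement y
  have hC : ∀ x, x ∈ C ↔ ∀ y ∈ B, |x| ⊓ |y| = 0 := fun x => by
    simp [C, Submodule.mem_iInf, mem_disjointComplement]
  have hBC : IsCompl B C := by
    refine ⟨?_, ?_⟩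
    · rw [Submodule.disjoint_def]
      exact fun x hx hx' => eq_zero_of_abs_inf_abs_self ((hC x).1 hx' x hx)
    · rw [codisjoint_iff, Submodule.eq_top_iff']
      intro x
      obtain ⟨s, hs, hs'⟩ := exists_band_decomposition_of_nonneg hB (posPart_nonneg x)
      obtain ⟨t, ht, ht'⟩ := exists_band_decomposition_of_nonneg hB (negPart_nonneg x)
      refine Submodule.mem_sup.2 ⟨s - t, B.sub_mem hs ht, (x⁺ - s) - (x⁻ - t),
        C.sub_mem ((hC _).2 hs') ((hC _).2 ht'), ?_⟩
      calc s - t + (x⁺ - s - (x⁻ - t)) = x⁺ - x⁻ := by abel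
        _ = x := posPart_sub_negPart x
  refine ⟨B.subtype ∘ₗ Submodule.projectionOnto B C hBC, fun x => ⟨?_, ?_⟩⟩
  · simp
  · rw [← hC]
    have := Submodule.projectionOnto_apply_eq_zero_iff hBC
      (x := x - (Submodule.projectionOnto B C hBC x : E))
    refine this.1 ?_
    rw [map_sub, Submodule.projectionOnto_apply_left, sub_self]

section ProjectionOnto

variable {B : Submodule ℝ E} {P : E →ₗ[ℝ] E}

theorem projection_eq_self (hP : ∀ x, P x ∈ B ∧ ∀ y ∈ B, |x - P x| ⊓ |y| = 0) {x : E}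
    (hx : x ∈ B) : P x = x :=
  (sub_eq_zero.1 (eq_zero_of_abs_inf_abs_self
    ((hP x).2 _ (B.sub_mem hx (hP x).1)))).symm

theorem projection_eq_zero (hP : ∀ x, P x ∈ B ∧ ∀ y ∈ B, |x - P x| ⊓ |y| = 0) {x : E}
    (hx : ∀ y ∈ B, |x| ⊓ |y| = 0) : P x = 0 := by
  have h1 : x - (x - P x) ∈ disjointComplement (P x) :=
    Submodule.sub_mem _ (hx _ (hP x).1) ((hP x).2 _ (hP x).1)
  rw [sub_sub_cancel] at h1
  exact eq_zero_of_abs_inf_abs_self h1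

end ProjectionOnto

namespace IsBandProjection

variable {P : E →ₗ[ℝ] E}

theorem nonneg (hP : IsBandProjection P) {x : E} (hx : 0 ≤ x) : 0 ≤ P x := (hP.bounds hx).1

theorem le_self (hP : IsBandProjection P) {x : E} (hx : 0 ≤ x) : P x ≤ x := (hP.bounds hx).2

theorem mono (hP : IsBandProjection P) {x y : E} (hxy : x ≤ y) : P x ≤ P y :=
  map_mono_of_nonneg (fun _ => hP.nonneg) hxy

theorem idem (hP : IsBandProjection P) (x : E) : P (P x) = P x := by
  obtain ⟨B, -, hB⟩ := hP
  exact projection_eq_self hB (hB x).1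

theorem sub_mono (hP : IsBandProjection P) {x y : E} (hxy : x ≤ y) : x - P x ≤ y - P y := by
  have := hP.le_self (sub_nonneg.2 hxy)
  rw [map_sub] at this
  rwa [← sub_nonneg, sub_sub_sub_comm, sub_nonneg]

theorem linearMap_id : IsBandProjection (LinearMap.id : E →ₗ[ℝ] E) :=
  ⟨⊤, isBand_top, fun x => ⟨trivial, fun y _ => by
    rw [LinearMap.id_apply, sub_self, abs_zero]
    exact inf_of_le_left (abs_nonneg y)⟩⟩

end IsBandProjection

/-- The band projection onto the part of the space on which `w` is nonnegative, that is, onto the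
disjoint complement of the negative part of `w`. -/
noncomputable def nonnegProj (w : E) : E →ₗ[ℝ] E :=
  (exists_projection_onto_band (isBand_disjointComplement w⁻)).choose

theorem nonnegProj_spec (w x : E) : nonnegProj w x ∈ disjointComplement w⁻ ∧
    ∀ y ∈ disjointComplement w⁻, |x - nonnegProj w x| ⊓ |y| = 0 :=
  (exists_projection_onto_band (isBand_disjointComplement w⁻)).choose_spec x

theorem isBandProjection_nonnegProj (w : E) : IsBandProjection (nonnegProj w) :=
  ⟨_, isBand_disjointComplement w⁻, nonnegProj_spec w⟩

theorem nonnegProj_self (w : E) : nonnegProj w w = w⁺ := by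
  have h1 : nonnegProj w w⁺ = w⁺ := projection_eq_self (nonnegProj_spec w) (by
    rw [mem_disjointComplement, abs_of_nonneg (posPart_nonneg w), abs_of_nonneg (negPart_nonneg w)]
    exact posPart_inf_negPart_eq_zero w)
  have h2 : nonnegProj w w⁻ = 0 := projection_eq_zero (nonnegProj_spec w) fun y hy => by
    rw [inf_comm]; exact hy
  nth_rewrite 2 [← posPart_sub_negPart w]
  rw [map_sub, h1, h2, sub_zero]

theorem nonnegProj_mono {v w : E} (hvw : v ≤ w) {x : E} (hx : 0 ≤ x) :
    nonnegProj v x ≤ nonnegProj w x := by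
  have h1 : nonnegProj v x ∈ disjointComplement w⁻ := by
    have h2 := (nonnegProj_spec v x).1
    rw [mem_disjointComplement] at h2 ⊢
    refine le_antisymm ((inf_le_inf_left _ ?_).trans_eq h2) (le_inf (abs_nonneg _) (abs_nonneg _))
    rw [abs_of_nonneg (negPart_nonneg v), abs_of_nonneg (negPart_nonneg w)]
    exact negPart_anti hvw
  rw [← projection_eq_self (nonnegProj_spec w) h1]
  exact (isBandProjection_nonnegProj w).mono ((isBandProjection_nonnegProj v).le_self hx)

/-- On the part where `u ≥ v`, the projection respects this inequality. -/
theorem nonnegProj_sub_le (u v : E) : nonnegProj (u - v) v ≤ nonnegProj (u - v) u := by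
  have h := posPart_nonneg (u - v)
  rwa [← nonnegProj_self, map_sub, sub_nonneg] at h

/-- Off the part where `u ≥ v`, the reverse inequality holds. -/
theorem sub_nonnegProj_sub_le (u v : E) :
    u - nonnegProj (u - v) u ≤ v - nonnegProj (u - v) v := by
  have h := le_posPart (u - v)
  rw [← nonnegProj_self, map_sub] at h
  rw [sub_le_sub_iff]
  rw [sub_le_sub_iff] at h
  rwa [add_comm v]

/-! ### Order convergence of sequences -/

theorem OrderTendsto.of_le {x y : ℕ → E} (hy : OrderTendsto y 0) (hx : ∀ n, 0 ≤ x n)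
    (hxy : ∀ n, x n ≤ y n) : OrderTendsto x 0 := by
  obtain ⟨p, hp, hp0, h⟩ := hy
  refine ⟨p, hp, hp0, fun n => ?_⟩
  rw [sub_zero, abs_of_nonneg (hx n)]
  have := h n
  rw [sub_zero] at this
  exact (hxy n).trans ((le_abs_self _).trans this)

theorem orderTendsto_zero_of_antitone {p : ℕ → E} (hp : Antitone p)
    (h0 : IsGLB (Set.range p) 0) : OrderTendsto p 0 :=
  ⟨p, hp, h0, fun n => by rw [sub_zero, abs_of_nonneg (h0.1 ⟨n, rfl⟩)]⟩

theorem isGLB_range_add {p q : ℕ → E} (hp : Antitone p) (hq : Antitone q)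
    (hp0 : IsGLB (Set.range p) 0) (hq0 : IsGLB (Set.range q) 0) :
    IsGLB (Set.range fun n => p n + q n) 0 := by
  refine ⟨?_, fun w hw => ?_⟩
  · rintro _ ⟨n, rfl⟩
    exact add_nonneg (hp0.1 ⟨n, rfl⟩) (hq0.1 ⟨n, rfl⟩)
  · have h1 : ∀ m, w - p m ≤ 0 := fun m => hq0.2 (by
      rintro _ ⟨n, rfl⟩
      rw [sub_le_iff_le_add']
      exact (hw ⟨max m n, rfl⟩).trans
        (add_le_add (hp (le_max_left m n)) (hq (le_max_right m n))))
    exact hp0.2 (by rintro _ ⟨m, rfl⟩; exact sub_nonpos.1 (h1 m))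

theorem isGLB_range_smul {p : ℕ → E} (hp0 : IsGLB (Set.range p) 0) {c : ℝ} (hc : 0 < c) :
    IsGLB (Set.range fun n => c • p n) 0 := by
  refine ⟨?_, fun w hw => ?_⟩
  · rintro _ ⟨n, rfl⟩
    exact smul_nonneg hc.le (hp0.1 ⟨n, rfl⟩)
  · have h1 : c⁻¹ • w ≤ 0 := hp0.2 (by
      rintro _ ⟨n, rfl⟩
      rw [smul_le_iff_le_inv_smul (inv_pos.2 hc), inv_inv]
      exact hw ⟨n, rfl⟩)
    rw [smul_le_iff_le_inv_smul (inv_pos.2 hc)] at h1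
    simpa using h1

theorem OrderTendsto.add {x y : ℕ → E} (hx : OrderTendsto x 0) (hy : OrderTendsto y 0) :
    OrderTendsto (fun n => x n + y n) 0 := by
  obtain ⟨p, hp, hp0, h⟩ := hx
  obtain ⟨q, hq, hq0, h'⟩ := hy
  refine ⟨fun n => p n + q n, fun m n hmn => add_le_add (hp hmn) (hq hmn),
    isGLB_range_add hp hq hp0 hq0, fun n => ?_⟩
  rw [sub_zero]
  have h1 := h n
  have h2 := h' n
  rw [sub_zero] at h1 h2
  exact (abs_add_le _ _).trans (add_le_add h1 h2)

theorem OrderTendsto.smul {x : ℕ → E} (hx : OrderTendsto x 0) (c : ℝ) :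
    OrderTendsto (fun n => c • x n) 0 := by
  obtain ⟨p, hp, hp0, h⟩ := hx
  refine ⟨fun n => (|c| + 1) • p n, fun m n hmn =>
    smul_le_smul_of_nonneg_left (hp hmn) (by positivity),
    isGLB_range_smul hp0 (by positivity), fun n => ?_⟩
  have h1 := h n
  rw [sub_zero] at h1 ⊢
  refine (abs_smul_eq c _).trans ((smul_le_smul_of_nonneg_left h1 (abs_nonneg c)).trans ?_)
  exact rsmul_le (hp0.1 ⟨n, rfl⟩) (by linarith)

/-- A positive sequence converges to `0` in order as soon as it is dominated, for each `i`, by an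
order null sequence plus a constant `z i`, where the constants have infimum at most `0`. The tail
suprema of the sequence decrease to `0`. -/
theorem orderTendsto_zero_of_le_add {ι : Type*} [Nonempty ι] {x : ℕ → E} (hx : ∀ n, 0 ≤ x n)
    {y : ι → ℕ → E} (hy : ∀ i, OrderTendsto (y i) 0) {z : ι → E}
    (hxy : ∀ i n, x n ≤ y i n + z i) (hz : ∀ w, (∀ i, w ≤ z i) → w ≤ 0) : OrderTendsto x 0 := by
  choose q hq hq0 hyq using hy
  have hxq : ∀ i n, x n ≤ q i n + z i := fun i n => by
    have := hyq i n
    rw [sub_zero] at this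
    exact (hxy i n).trans (add_le_add_left ((le_abs_self _).trans this) _)
  have tail : ∀ i n m, x (n + m) ≤ q i n + z i := fun i n m =>
    (hxq i (n + m)).trans (add_le_add_left (hq i (Nat.le_add_right n m)) _)
  have bdd : ∀ n, BddAbove (Set.range fun m => x (n + m)) := fun n =>
    ⟨q (Classical.arbitrary ι) n + z (Classical.arbitrary ι), by
      rintro _ ⟨m, rfl⟩; exact tail _ n m⟩
  have le : ∀ n, x n ≤ ⨆ m, x (n + m) := fun n => le_ciSup (bdd n) 0
  refine ⟨fun n => ⨆ m, x (n + m), fun n n' hn => ?_, ⟨?_, fun w hw => ?_⟩, fun n => ?_⟩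
  · refine ciSup_le fun m => ?_
    have := le_ciSup (bdd n) (n' - n + m)
    rwa [← add_assoc, Nat.add_sub_cancel' hn] at this
  · rintro _ ⟨n, rfl⟩
    exact (hx n).trans (le n)
  · refine hz w fun i => ?_
    refine sub_nonpos.1 ((hq0 i).2 ?_)
    rintro _ ⟨n, rfl⟩
    rw [sub_le_iff_le_add]
    exact (hw ⟨n, rfl⟩).trans (ciSup_le fun m => tail i n m)
  · rw [sub_zero, abs_of_nonneg (hx n)]
    exact le n

theorem isGLB_range_inv_smul {u : E} (hu : 0 ≤ u) :
    IsGLB (Set.range fun n : ℕ => ((n : ℝ) + 1)⁻¹ • u) 0 := by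
  refine ⟨?_, fun w hw => ?_⟩
  · rintro _ ⟨n, rfl⟩
    exact smul_nonneg (by positivity) hu
  · refine le_zero_of_le_smul (u := u) fun ε hε => ?_
    obtain ⟨n, hn⟩ := exists_nat_one_div_lt hε
    rw [one_div] at hn
    exact (hw ⟨n, rfl⟩).trans (rsmul_le hu hn.le)

theorem antitone_inv_smul {u : E} (hu : 0 ≤ u) :
    Antitone fun n : ℕ => ((n : ℝ) + 1)⁻¹ • u := fun m n hmn =>
  rsmul_le hu (by
    have : (m : ℝ) ≤ n := by exact_mod_cast hmn
    gcongr)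

theorem orderTendsto_inv_smul {u : E} (hu : 0 ≤ u) :
    OrderTendsto (fun n : ℕ => (n : ℝ)⁻¹ • u) 0 := by
  have h := (orderTendsto_zero_of_antitone (antitone_inv_smul hu)
    (isGLB_range_inv_smul hu)).smul 2
  refine h.of_le (fun n => smul_nonneg (by positivity) hu) fun n => ?_
  rw [smul_smul]
  refine rsmul_le hu ?_
  rcases Nat.eq_zero_or_pos n with rfl | hn
  · simp
  · have hn' : (1 : ℝ) ≤ n := by exact_mod_cast hn
    rw [← div_eq_mul_inv, inv_eq_one_div, div_le_div_iff₀ (by positivity) (by positivity)]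
    linarith

theorem inv_smul_sum_le {x : ℕ → E} {u : E} (hu : 0 ≤ u) (hx : ∀ k, x k ≤ u) (n : ℕ) :
    (n : ℝ)⁻¹ • ∑ k ∈ Finset.range n, x k ≤ u := by
  have h := Finset.sum_le_card_nsmul (Finset.range n) x u fun k _ => hx k
  rw [Finset.card_range, ← Nat.cast_smul_eq_nsmul ℝ] at h
  rcases Nat.eq_zero_or_pos n with rfl | hn
  · simpa using hu
  · have hn' : (0 : ℝ) < n := by exact_mod_cast hn
    have := smul_le_smul_of_nonneg_left h (inv_nonneg.2 hn'.le)
    rwa [smul_smul, inv_mul_cancel₀ hn'.ne', one_smul] at this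

theorem inv_smul_sum_nonneg {x : ℕ → E} (hx : ∀ k, 0 ≤ x k) (n : ℕ) :
    0 ≤ (n : ℝ)⁻¹ • ∑ k ∈ Finset.range n, x k :=
  smul_nonneg (by positivity) (Finset.sum_nonneg fun k _ => hx k)

theorem inv_smul_sum_mono {x y : ℕ → E} (hxy : ∀ k, x k ≤ y k) (n : ℕ) :
    (n : ℝ)⁻¹ • ∑ k ∈ Finset.range n, x k ≤ (n : ℝ)⁻¹ • ∑ k ∈ Finset.range n, y k :=
  smul_le_smul_of_nonneg_left (Finset.sum_le_sum fun k _ => hxy k) (by positivity)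

theorem inv_smul_sum_add (x y : ℕ → E) (n : ℕ) :
    (n : ℝ)⁻¹ • ∑ k ∈ Finset.range n, (x k + y k) =
      (n : ℝ)⁻¹ • ∑ k ∈ Finset.range n, x k + (n : ℝ)⁻¹ • ∑ k ∈ Finset.range n, y k := by
  rw [Finset.sum_add_distrib, smul_add]

/-- Cesàro averages of a positive order null sequence are order null. -/
theorem OrderTendsto.average {x : ℕ → E} (hx0 : ∀ n, 0 ≤ x n) (hx : OrderTendsto x 0) :
    OrderTendsto (fun n : ℕ => (n : ℝ)⁻¹ • ∑ k ∈ Finset.range n, x k) 0 := by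
  obtain ⟨p, hp, hp0, h⟩ := hx
  have hpn : ∀ n, 0 ≤ p n := fun n => hp0.1 ⟨n, rfl⟩
  have hxp : ∀ n, x n ≤ p n := fun n => by
    have := h n
    rw [sub_zero] at this
    exact (le_abs_self _).trans this
  refine orderTendsto_zero_of_le_add (inv_smul_sum_nonneg hx0)
    (fun N : ℕ => orderTendsto_inv_smul (smul_nonneg (Nat.cast_nonneg (α := ℝ) N) (hpn 0)))
    (z := p) (fun N n => ?_) fun w hw => hp0.2 (by rintro _ ⟨n, rfl⟩; exact hw n)
  have h1 : ∀ k, x k ≤ (if k < N then p 0 else 0) + p N := fun k => by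
    refine (hxp k).trans ?_
    split_ifs with hk
    · exact (hp (Nat.zero_le k)).trans (le_add_of_nonneg_right (hpn N))
    · rw [zero_add]
      exact hp (not_lt.1 hk)
  refine (inv_smul_sum_mono h1 n).trans ?_
  rw [inv_smul_sum_add]
  refine add_le_add (smul_le_smul_of_nonneg_left ?_ (by positivity))
    (inv_smul_sum_le (hpn N) (fun _ => le_rfl) n)
  rw [← Finset.sum_filter, Finset.sum_const, ← Nat.cast_smul_eq_nsmul ℝ]
  refine rsmul_le (hpn 0) (Nat.cast_le.2 ?_)
  refine (Finset.card_le_card (t := Finset.range N) fun k hk => ?_).trans_eq (Finset.card_range N)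
  exact Finset.mem_range.2 (Finset.mem_filter.1 hk).2

/-! ### Infima of decreasing sequences of positive operators -/

/-- An additive and positively homogeneous function on the positive cone extends to a linear
operator. -/
theorem exists_linearMap_eq_on_cone (g : E → E)
    (hadd : ∀ x y, 0 ≤ x → 0 ≤ y → g (x + y) = g x + g y)
    (hsmul : ∀ (c : ℝ) (x : E), 0 ≤ c → 0 ≤ x → g (c • x) = c • g x) :
    ∃ U : E →ₗ[ℝ] E, ∀ x, 0 ≤ x → U x = g x := by
  have key : ∀ a b : E, 0 ≤ a → 0 ≤ b → g (a - b)⁺ - g (a - b)⁻ = g a - g b := fun a b ha hb => by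
    have h1 : (a - b)⁺ + b = a + (a - b)⁻ := by
      have := posPart_sub_negPart (a - b)
      rw [sub_eq_sub_iff_add_eq_add] at this
      exact this
    have h2 := congrArg g h1
    rw [hadd _ _ (posPart_nonneg _) hb, hadd _ _ ha (negPart_nonneg _)] at h2
    rwa [sub_eq_sub_iff_add_eq_add]
  refine ⟨{ toFun := fun x => g x⁺ - g x⁻, map_add' := fun x y => ?_, map_smul' := fun c x => ?_ },
    fun x hx => ?_⟩
  · have h1 : x + y = (x⁺ + y⁺) - (x⁻ + y⁻) := by
      rw [add_sub_add_comm, posPart_sub_negPart, posPart_sub_negPart]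
    rw [h1, key _ _ (add_nonneg (posPart_nonneg _) (posPart_nonneg _))
      (add_nonneg (negPart_nonneg _) (negPart_nonneg _)),
      hadd _ _ (posPart_nonneg _) (posPart_nonneg _),
      hadd _ _ (negPart_nonneg _) (negPart_nonneg _)]
    abel
  · rw [RingHom.id_apply]
    rcases le_total 0 c with hc | hc
    · have h1 : c • x = c • x⁺ - c • x⁻ := by rw [← smul_sub, posPart_sub_negPart]
      rw [h1, key _ _ (smul_nonneg hc (posPart_nonneg _)) (smul_nonneg hc (negPart_nonneg _)),
        hsmul _ _ hc (posPart_nonneg _), hsmul _ _ hc (negPart_nonneg _), smul_sub]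
    · have hc' : 0 ≤ -c := neg_nonneg.2 hc
      have h1 : c • x = (-c) • x⁻ - (-c) • x⁺ := by
        rw [← smul_sub, ← neg_sub, posPart_sub_negPart, neg_smul, smul_neg, neg_neg]
      rw [h1, key _ _ (smul_nonneg hc' (negPart_nonneg _)) (smul_nonneg hc' (posPart_nonneg _)),
        hsmul _ _ hc' (posPart_nonneg _), hsmul _ _ hc' (negPart_nonneg _)]
      module
  · have h1 := key x 0 hx le_rfl
    have h2 := hsmul 0 0 le_rfl le_rfl
    rw [zero_smul, zero_smul] at h2
    rw [sub_zero, h2, sub_zero] at h1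
    exact h1

/-- The infimum of a decreasing sequence of positive operators exists and is computed pointwise on
the positive cone. -/
theorem exists_operator_isGLB {V : ℕ → E →ₗ[ℝ] E} (h0 : ∀ n, OpLE 0 (V n))
    (hV : ∀ m n, m ≤ n → OpLE (V n) (V m)) :
    ∃ U : E →ₗ[ℝ] E, ∀ x, 0 ≤ x → IsGLB (Set.range fun n => V n x) (U x) := by
  have glb : ∀ x, 0 ≤ x → IsGLB (Set.range fun n => V n x) (⨅ n, V n x) := fun x hx =>
    isGLB_ciInf ⟨0, by rintro _ ⟨n, rfl⟩; exact h0 n x hx⟩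
  have le : ∀ x, 0 ≤ x → ∀ n, ⨅ n, V n x ≤ V n x := fun x hx n => (glb x hx).1 ⟨n, rfl⟩
  have ge : ∀ x w, 0 ≤ x → (∀ n, w ≤ V n x) → w ≤ ⨅ n, V n x := fun x w hx h =>
    (glb x hx).2 (by rintro _ ⟨n, rfl⟩; exact h n)
  have hsmul' : ∀ (c : ℝ) (x : E), 0 < c → 0 ≤ x → c • ⨅ n, V n x ≤ ⨅ n, V n (c • x) :=
    fun c x hc hx => ge _ _ (smul_nonneg hc.le hx) fun n => by
      rw [map_smul]
      exact smul_le_smul_of_nonneg_left (le x hx n) hc.le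
  have hext := exists_linearMap_eq_on_cone (fun x => ⨅ n, V n x) ?_ ?_
  · obtain ⟨U, hU⟩ := hext
    exact ⟨U, fun x hx => by rw [hU x hx]; exact glb x hx⟩
  · intro x y hx hy
    refine le_antisymm ?_ (ge _ _ (add_nonneg hx hy) fun n => by
      rw [map_add]; exact add_le_add (le x hx n) (le y hy n))
    rw [← sub_le_iff_le_add]
    refine ge _ _ hx fun n => ?_
    rw [sub_le_comm]
    refine ge _ _ hy fun m => ?_
    rw [sub_le_iff_le_add']
    refine (le _ (add_nonneg hx hy) (max m n)).trans ?_
    rw [map_add]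
    exact add_le_add (hV _ _ (le_max_right m n) x hx) (hV _ _ (le_max_left m n) y hy)
  · intro c x hc hx
    rcases hc.eq_or_lt with rfl | hc
    · simp
    · refine le_antisymm ?_ (hsmul' c x hc hx)
      have := hsmul' c⁻¹ (c • x) (inv_pos.2 hc) (smul_nonneg hc.le hx)
      rw [smul_smul, inv_mul_cancel₀ hc.ne', one_smul, smul_le_iff_le_inv_smul (inv_pos.2 hc),
        inv_inv] at this
      exact this

theorem OpOrderTendstoZero.apply {A : ℕ → E →ₗ[ℝ] E} (hA : OpOrderTendstoZero A) {x : E}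
    (hx : 0 ≤ x) : OrderTendsto (fun n => A n x) 0 := by
  obtain ⟨U, hU, hU0, hinf, hAU⟩ := hA
  obtain ⟨V, hV⟩ := exists_operator_isGLB hU0 hU
  have hVx : V x = 0 := le_antisymm
    (hinf V (fun n y hy => (hV y hy).1 ⟨n, rfl⟩) x hx)
    ((hV x hx).2 (by rintro _ ⟨n, rfl⟩; exact hU0 n x hx))
  refine ⟨fun n => U n x, fun m n hmn => hU m n hmn x hx, hVx ▸ hV x hx, fun n => ?_⟩
  rw [sub_zero]
  exact abs_le'.2 ⟨(hAU n).2 x hx, neg_le.1 ((hAU n).1 x hx)⟩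

/-! ### Comparison of operators at a weak order unit -/

theorem IsWeakOrderUnit.eq_zero_of_inf_nonpos {e u : E} (he : IsWeakOrderUnit e) (hu : 0 ≤ u)
    (h : u ⊓ e ≤ 0) : u = 0 :=
  he.2 u (by rw [abs_of_nonneg hu]; exact le_antisymm h (le_inf hu he.1))

/-- A weak order unit `e` recovers `x ≥ 0` as the supremum of the truncations `x ⊓ k e`. -/
theorem IsWeakOrderUnit.le_zero_of_le_sub_inf {e x w : E} (he : IsWeakOrderUnit e) (hx : 0 ≤ x)
    (hw : ∀ k : ℕ, w ≤ x - x ⊓ (k : ℝ) • e) : w ≤ 0 := by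
  have hu : ∀ k : ℕ, w⁺ ≤ x - x ⊓ (k : ℝ) • e := fun k =>
    sup_le (hw k) (sub_nonneg.2 inf_le_left)
  have ind : ∀ k : ℕ, (k : ℝ) • (w⁺ ⊓ e) ≤ x ⊓ (k : ℝ) • e := fun k => by
    induction k with
    | zero => simpa using hx
    | succ k ih =>
      push_cast
      rw [add_smul, one_smul, add_smul, one_smul]
      refine (add_le_add_left ih _).trans (le_inf ?_ (add_le_add inf_le_right inf_le_right))
      exact (add_le_add_right inf_le_left _).trans (le_sub_iff_add_le'.1 (hu k))
  have h := archimedean fun k => (ind k).trans inf_le_left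
  exact (le_posPart w).trans_eq (he.eq_zero_of_inf_nonpos (posPart_nonneg w) h)

/-- An operator `A` with `|A x| ≤ C |x|` that is nonpositive at a weak order unit is nonpositive:
for `x` in `E_e` one has `A x ≤ C |x - a e|` for all real `a`, and only `0` and negative elements
are below all these distances. The general case follows by truncation. -/
theorem IsWeakOrderUnit.map_nonpos {e : E} (he : IsWeakOrderUnit e) {A : E →ₗ[ℝ] E} {C : ℝ}
    (hC : 0 < C) (hA : ∀ x, |A x| ≤ C • |x|) (hAe : A e ≤ 0) {x : E} (hx : 0 ≤ x) : A x ≤ 0 := by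
  have bounded : ∀ y, 0 ≤ y → y ∈ eBounded e → A y ≤ 0 := fun y hy hye => by
    have h1 : ∀ a : ℝ, A y ≤ C • |y - a • e| := fun a => by
      rcases le_total 0 a with ha | ha
      · have h2 : A y = A (y - a • e) + a • A e := by rw [← map_smul, ← map_add, sub_add_cancel]
        rw [h2]
        refine (add_le_of_nonpos_right ?_).trans ((le_abs_self _).trans (hA _))
        have := smul_le_smul_of_nonneg_left hAe ha
        rwa [smul_zero] at this
      · refine (le_abs_self _).trans ((hA y).trans (smul_le_smul_of_nonneg_left ?_ hC.le))
        rw [abs_of_nonneg hy]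
        refine le_trans ?_ (le_abs_self _)
        have := smul_nonneg (neg_nonneg.2 ha) he.1
        rw [neg_smul] at this
        rw [sub_eq_add_neg]
        exact le_add_of_nonneg_right this
    have h3 := le_zero_of_le_abs_sub he.1 hye (g := C⁻¹ • A y) fun a => by
      rw [smul_le_iff_le_inv_smul (inv_pos.2 hC), inv_inv]
      exact h1 a
    rw [smul_le_iff_le_inv_smul (inv_pos.2 hC)] at h3
    simpa using h3
  have h4 : C⁻¹ • A x ≤ 0 := he.le_zero_of_le_sub_inf hx fun k => by
    rw [smul_le_iff_le_inv_smul (inv_pos.2 hC), inv_inv]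
    set y := x ⊓ (k : ℝ) • e with hy
    have hy0 : 0 ≤ y := le_inf hx (smul_nonneg (Nat.cast_nonneg k) he.1)
    have h5 := bounded y hy0 ⟨k, Nat.cast_nonneg k, by
      rw [abs_of_nonneg hy0]; exact inf_le_right⟩
    have h6 := (le_abs_self _).trans (hA (x - y))
    rw [abs_of_nonneg (sub_nonneg.2 inf_le_left), map_sub] at h6
    exact (le_sub_self_iff _ |>.2 h5).trans h6
  rw [smul_le_iff_le_inv_smul (inv_pos.2 hC)] at h4
  simpa using h4

/-- If `0 ≤ D ≤ I` and `D e ≤ r`, then `D ≤ c I` off the part where `r ≥ c e`. -/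
theorem IsWeakOrderUnit.sub_nonnegProj_le {e r : E} (he : IsWeakOrderUnit e) {D : E →ₗ[ℝ] E}
    (hD : ∀ x, 0 ≤ x → 0 ≤ D x ∧ D x ≤ x) (hDe : D e ≤ r) {c : ℝ} (hc : 0 < c) {x : E}
    (hx : 0 ≤ x) : D x - nonnegProj (r - c • e) (D x) ≤ c • (x - nonnegProj (r - c • e) x) := by
  set G := nonnegProj (r - c • e) with hG
  have hGp : IsBandProjection G := isBandProjection_nonnegProj _
  have h1 : (D - G ∘ₗ D - c • LinearMap.id : E →ₗ[ℝ] E) x ≤ 0 := by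
    refine he.map_nonpos (C := 1 + c) (by positivity) (fun y => ?_) ?_ hx
    · have hpos : ∀ z, 0 ≤ z → 0 ≤ (D - G ∘ₗ D) z := fun z hz => by
        simpa using hGp.le_self (hD z hz).1
      have h2 := abs_map_le_map_abs hpos y
      have h3 : (D - G ∘ₗ D) |y| ≤ |y| :=
        (sub_le_self _ (hGp.nonneg (hD _ (abs_nonneg y)).1)).trans (hD _ (abs_nonneg y)).2
      rw [LinearMap.sub_apply, sub_eq_add_neg, add_smul, one_smul]
      refine (abs_add_le _ _).trans (add_le_add (h2.trans h3) ?_)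
      rw [abs_neg, LinearMap.smul_apply, LinearMap.id_apply]
      simpa [abs_of_pos hc] using abs_smul_eq c y
    · have h2 := hGp.sub_mono hDe
      have h3 := sub_nonnegProj_sub_le r (c • e)
      have h4 : c • e - G (c • e) ≤ c • e :=
        sub_le_self _ (hGp.nonneg (smul_nonneg hc.le he.1))
      simpa using h2.trans (h3.trans h4)
  have h5 : D x - G (D x) ≤ c • x := by simpa using h1
  have h6 := hGp.sub_mono h5
  rw [map_sub, hGp.idem, sub_self, sub_zero, map_smul, ← smul_sub] at h6
  exact h6

/-- If `r n` decreases to `0`, then the band projections onto the parts where `r n ≥ c e` decrease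
to `0`. -/
theorem IsWeakOrderUnit.isGLB_nonnegProj {e : E} (he : IsWeakOrderUnit e) {r : ℕ → E}
    (hr0 : IsGLB (Set.range r) 0) {c : ℝ} (hc : 0 < c) {x : E} (hx : 0 ≤ x) :
    IsGLB (Set.range fun n => nonnegProj (r n - c • e) x) 0 := by
  refine ⟨?_, fun w hw => ?_⟩
  · rintro _ ⟨n, rfl⟩
    exact (isBandProjection_nonnegProj _).nonneg hx
  · have h1 : c • (w⁺ ⊓ e) ≤ 0 := hr0.2 (by
      rintro _ ⟨n, rfl⟩
      have hG := isBandProjection_nonnegProj (r n - c • e)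
      have h2 : w⁺ ≤ nonnegProj (r n - c • e) x := sup_le (hw ⟨n, rfl⟩) (hG.nonneg hx)
      have h3 : w⁺ ⊓ e ∈ disjointComplement (r n - c • e)⁻ := by
        refine disjointComplement_solid (nonnegProj_spec (r n - c • e) x).1 ?_
        rw [abs_of_nonneg (le_inf (posPart_nonneg w) he.1), abs_of_nonneg (hG.nonneg hx)]
        exact inf_le_left.trans h2
      rw [← projection_eq_self (nonnegProj_spec _) h3]
      refine (smul_le_smul_of_nonneg_left (hG.mono inf_le_right) hc.le).trans ?_
      rw [← map_smul]
      exact (nonnegProj_sub_le _ _).trans (hG.le_self (hr0.1 ⟨n, rfl⟩)))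
    rw [smul_le_iff_le_inv_smul hc, smul_zero] at h1
    exact (le_posPart w).trans_eq (he.eq_zero_of_inf_nonpos (posPart_nonneg w) h1)

/-! ### A criterion for order null sequences of operators -/

/-- The dyadic layer sum `2⁻ᴺ I + ∑_{j = 1}^N 2⁻ʲ G_j`, where `G_j` is the band projection onto the
part where `r ≥ 2⁻ʲ e`. It approximates multiplication by `r ⊓ e` from above. -/
noncomputable def layerSum (e r : E) (N : ℕ) : E →ₗ[ℝ] E :=
  (1 / 2 : ℝ) ^ N • LinearMap.id + ∑ j ∈ Finset.range N,
    (1 / 2 : ℝ) ^ (j + 1) • nonnegProj (r - (1 / 2 : ℝ) ^ (j + 1) • e)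

theorem layerSum_apply (e r : E) (N : ℕ) (x : E) :
    layerSum e r N x = (1 / 2 : ℝ) ^ N • x + ∑ j ∈ Finset.range N,
      (1 / 2 : ℝ) ^ (j + 1) • nonnegProj (r - (1 / 2 : ℝ) ^ (j + 1) • e) x := by
  simp [layerSum, LinearMap.sum_apply]

theorem layerSum_succ (e r : E) (N : ℕ) (x : E) :
    layerSum e r (N + 1) x = layerSum e r N x -
      (1 / 2 : ℝ) ^ (N + 1) • (x - nonnegProj (r - (1 / 2 : ℝ) ^ (N + 1) • e) x) := by
  rw [layerSum_apply, layerSum_apply, Finset.sum_range_succ, pow_succ]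
  module

theorem smul_le_layerSum (e r : E) (N : ℕ) {x : E} (hx : 0 ≤ x) :
    (1 / 2 : ℝ) ^ N • x ≤ layerSum e r N x := by
  rw [layerSum_apply]
  exact le_add_of_nonneg_right (Finset.sum_nonneg fun j _ =>
    smul_nonneg (by positivity) ((isBandProjection_nonnegProj _).nonneg hx))

theorem layerSum_mono {e r r' : E} (h : r ≤ r') (N : ℕ) {x : E} (hx : 0 ≤ x) :
    layerSum e r N x ≤ layerSum e r' N x := by
  rw [layerSum_apply, layerSum_apply]
  exact add_le_add_right (Finset.sum_le_sum fun j _ => smul_le_smul_of_nonneg_left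
    (nonnegProj_mono (sub_le_sub_right h _) hx) (by positivity)) _

theorem antitone_layerSum (e r : E) {x : E} (hx : 0 ≤ x) : Antitone fun N => layerSum e r N x :=
  antitone_nat_of_succ_le fun N => by
    rw [layerSum_succ]
    exact sub_le_self _ (smul_nonneg (by positivity)
      (sub_nonneg.2 ((isBandProjection_nonnegProj _).le_self hx)))

/-- An operator `0 ≤ D ≤ I` with `D e ≤ r` lies below all layer sums of `r`. -/
theorem IsWeakOrderUnit.le_layerSum {e r : E} (he : IsWeakOrderUnit e) {D : E →ₗ[ℝ] E}
    (hD : ∀ x, 0 ≤ x → 0 ≤ D x ∧ D x ≤ x) (hDe : D e ≤ r) (N : ℕ) {x : E} (hx : 0 ≤ x) :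
    D x ≤ layerSum e r N x := by
  induction N with
  | zero => simpa [layerSum_apply] using (hD x hx).2
  | succ N ih =>
    set c : ℝ := (1 / 2) ^ (N + 1) with hc
    set G := nonnegProj (r - c • e) with hG
    have hGp : IsBandProjection G := isBandProjection_nonnegProj _
    -- compare the two sides separately on the band of `G` and on its disjoint complement
    have h1 : G (D x) ≤ G (layerSum e r (N + 1) x) := by
      rw [layerSum_succ, map_sub, map_smul, map_sub, ← hc, ← hG, hGp.idem, sub_self, smul_zero,
        sub_zero]
      exact hGp.mono ih
    have h2 : D x - G (D x) ≤ layerSum e r (N + 1) x - G (layerSum e r (N + 1) x) := by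
      refine (he.sub_nonnegProj_le hD hDe (by positivity : 0 < c) hx).trans ?_
      have := hGp.sub_mono (smul_le_layerSum e r (N + 1) hx)
      rwa [map_smul, ← smul_sub] at this
    simpa using add_le_add h1 h2

/-- A sequence of operators between `0` and `I` converges to `0` in order as soon as its values at
a weak order unit are dominated by a sequence decreasing to `0`. -/
theorem IsWeakOrderUnit.opOrderTendstoZero {e : E} (he : IsWeakOrderUnit e) {D : ℕ → E →ₗ[ℝ] E}
    (hD : ∀ n x, 0 ≤ x → 0 ≤ D n x ∧ D n x ≤ x) {r : ℕ → E} (hr : Antitone r)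
    (hr0 : IsGLB (Set.range r) 0) (hDe : ∀ n, D n e ≤ r n) : OpOrderTendstoZero D := by
  have hpos : ∀ n N, OpLE 0 (layerSum e (r n) N) := fun n N x hx =>
    (smul_nonneg (by positivity) hx).trans (smul_le_layerSum e (r n) N hx)
  choose U hU using fun n => exists_operator_isGLB (hpos n)
    fun _ _ hmn x hx => antitone_layerSum e (r n) hx hmn
  have hDU : ∀ n, OpLE (D n) (U n) := fun n x hx => (hU n x hx).2 (by
    rintro _ ⟨N, rfl⟩
    exact he.le_layerSum (hD n) (hDe n) N hx)
  have hU0 : ∀ n, OpLE 0 (U n) := fun n x hx => (hD n x hx).1.trans (hDU n x hx)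
  refine ⟨U, fun m n hmn x hx => (hU m x hx).2 ?_, hU0, fun W hW x hx => ?_, fun n =>
    ⟨fun x hx => ?_, hDU n⟩⟩
  · rintro _ ⟨N, rfl⟩
    exact ((hU n x hx).1 ⟨N, rfl⟩).trans (layerSum_mono (hr hmn) N hx)
  · have glb : ∀ N : ℕ, Antitone (fun n => ∑ j ∈ Finset.range N,
        (1 / 2 : ℝ) ^ (j + 1) • nonnegProj (r n - (1 / 2 : ℝ) ^ (j + 1) • e) x) ∧
        IsGLB (Set.range fun n => ∑ j ∈ Finset.range N,
        (1 / 2 : ℝ) ^ (j + 1) • nonnegProj (r n - (1 / 2 : ℝ) ^ (j + 1) • e) x) 0 := fun N => by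
      induction N with
      | zero => simp [antitone_const]
      | succ N ih =>
        simp only [Finset.sum_range_succ]
        have h1 : Antitone fun n => (1 / 2 : ℝ) ^ (N + 1) •
            nonnegProj (r n - (1 / 2 : ℝ) ^ (N + 1) • e) x := fun m n hmn =>
          smul_le_smul_of_nonneg_left (nonnegProj_mono (sub_le_sub_right (hr hmn) _) hx)
            (by positivity)
        exact ⟨ih.1.add h1, isGLB_range_add ih.1 h1 ih.2
          (isGLB_range_smul (he.isGLB_nonnegProj hr0 (by positivity) hx) (by positivity))⟩
    have h2 : ∀ N : ℕ, W x ≤ (1 / 2 : ℝ) ^ N • x := fun N => by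
      rw [← sub_nonpos]
      refine (glb N).2.2 ?_
      rintro _ ⟨n, rfl⟩
      rw [sub_le_iff_le_add', ← layerSum_apply]
      exact (hW n x hx).trans ((hU n x hx).1 ⟨N, rfl⟩)
    refine le_zero_of_le_smul (u := x) fun ε hε => ?_
    obtain ⟨N, hN⟩ := exists_pow_lt_of_lt_one hε (by norm_num : (1 / 2 : ℝ) < 1)
    exact (h2 N).trans (rsmul_le hx hN.le)
  · exact (neg_nonpos.2 (hU0 n x hx)).trans (hD n x hx).1

/-! ### Square roots and the Koopman–von Neumann lemma -/

/-- The square root of `p ≥ 0` with respect to the unit `e`, as a supremum of `p / c ⊓ c e` over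
all `c > 0`. -/
noncomputable def unitSqrt (e p : E) : E :=
  ⨆ c : Set.Ioi (0 : ℝ), ((c : ℝ)⁻¹ • p ⊓ (c : ℝ) • e)

section UnitSqrt

variable {e p q : E}

theorem inv_smul_inf_smul_le (he : 0 ≤ e) (hp : 0 ≤ p) {b c : ℝ} (hc : 0 < c) :
    b⁻¹ • p ⊓ b • e ≤ c • e + c⁻¹ • p := by
  rcases le_total b c with h | h
  · exact inf_le_right.trans ((rsmul_le he h).trans
      (le_add_of_nonneg_right (smul_nonneg (by positivity) hp)))
  · exact inf_le_left.trans ((rsmul_le hp (by gcongr)).trans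
      (le_add_of_nonneg_left (smul_nonneg hc.le he)))

theorem unitSqrt_le (he : 0 ≤ e) (hp : 0 ≤ p) {c : ℝ} (hc : 0 < c) :
    unitSqrt e p ≤ c • e + c⁻¹ • p :=
  haveI : Nonempty (Set.Ioi (0 : ℝ)) := ⟨⟨1, Set.mem_Ioi.2 one_pos⟩⟩
  ciSup_le fun _ => inv_smul_inf_smul_le he hp hc

theorem le_unitSqrt (he : 0 ≤ e) (hp : 0 ≤ p) {c : ℝ} (hc : 0 < c) :
    c⁻¹ • p ⊓ c • e ≤ unitSqrt e p :=
  le_ciSup (f := fun c : Set.Ioi (0 : ℝ) => ((c : ℝ)⁻¹ • p ⊓ (c : ℝ) • e))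
    ⟨(1 : ℝ) • e + (1 : ℝ)⁻¹ • p, by
      rintro _ ⟨b, rfl⟩; exact inv_smul_inf_smul_le he hp one_pos⟩ ⟨c, hc⟩

theorem unitSqrt_nonneg (he : 0 ≤ e) (hp : 0 ≤ p) : 0 ≤ unitSqrt e p :=
  le_trans (le_inf (smul_nonneg (by positivity) hp) (smul_nonneg zero_le_one he))
    (le_unitSqrt he hp one_pos)

theorem unitSqrt_mono (he : 0 ≤ e) (hp : 0 ≤ p) (hpq : p ≤ q) : unitSqrt e p ≤ unitSqrt e q :=
  haveI : Nonempty (Set.Ioi (0 : ℝ)) := ⟨⟨1, Set.mem_Ioi.2 one_pos⟩⟩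
  ciSup_le fun b => (inf_le_inf_right _ (smul_le_smul_of_nonneg_left hpq
    (inv_nonneg.2 (le_of_lt b.2)))).trans (le_unitSqrt he (hp.trans hpq) b.2)

theorem isGLB_unitSqrt (he : 0 ≤ e) {p : ℕ → E} (hp0 : IsGLB (Set.range p) 0) :
    IsGLB (Set.range fun n => unitSqrt e (p n)) 0 := by
  have hpn : ∀ n, 0 ≤ p n := fun n => hp0.1 ⟨n, rfl⟩
  refine ⟨?_, fun w hw => le_zero_of_le_smul (u := e) fun c hc => ?_⟩
  · rintro _ ⟨n, rfl⟩
    exact unitSqrt_nonneg he (hpn n)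
  · rw [← sub_nonpos]
    refine (isGLB_range_smul hp0 (inv_pos.2 hc)).2 ?_
    rintro _ ⟨n, rfl⟩
    rw [sub_le_iff_le_add']
    exact (hw ⟨n, rfl⟩).trans (unitSqrt_le he (hpn n) hc)

/-- Division by the square root: if `0 ≤ D ≤ I` and `D √p ≤ p`, then `D e ≤ √p`, provided that `p`
is bounded away from `0`. At a point where `p = c ^ 2` both inequalities are scalar ones; the error
made by pretending that `p = c ^ 2` is at most a constant times `|p - c ^ 2 e|`. -/
theorem map_unit_le_unitSqrt (he : 0 ≤ e) {D : E →ₗ[ℝ] E}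
    (hD : ∀ x, 0 ≤ x → 0 ≤ D x ∧ D x ≤ x) {η : ℝ} (hη : 0 < η) (hηp : η • e ≤ p)
    (hpe : p ∈ eBounded e) (hDp : D (unitSqrt e p) ≤ p) : D e ≤ unitSqrt e p := by
  have hp : 0 ≤ p := (smul_nonneg hη.le he).trans hηp
  set r := unitSqrt e p with hr
  have near : ∀ c : ℝ, 0 < c → D e - r ≤ (c⁻¹ + c⁻¹ * c⁻¹) • |p - (c * c) • e| := fun c hc => by
    set q := |p - (c * c) • e| with hq
    have hq0 : 0 ≤ q := abs_nonneg _
    have q1 : (c * c) • e - q ≤ p := by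
      rw [sub_le_comm, ← neg_sub p]
      exact neg_le_abs _
    have q2 : p - q ≤ (c * c) • e := by
      rw [sub_le_comm]
      exact le_abs_self _
    have hcc : c⁻¹ * (c * c) = c := by field_simp
    have r1 : c • e - c⁻¹ • q ≤ r := by
      refine le_trans (le_inf ?_ ?_) (le_unitSqrt he hp hc)
      · have := smul_le_smul_of_nonneg_left q1 (inv_nonneg.2 hc.le)
        rwa [smul_sub, smul_smul, hcc] at this
      · exact sub_le_self _ (smul_nonneg (by positivity) hq0)
    have r2 : c⁻¹ • p - c⁻¹ • q ≤ r := by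
      refine le_trans (le_inf ?_ ?_) (le_unitSqrt he hp hc)
      · exact sub_le_self _ (smul_nonneg (by positivity) hq0)
      · have := smul_le_smul_of_nonneg_left q2 (inv_nonneg.2 hc.le)
        rwa [smul_sub, smul_smul, hcc] at this
    have d1 := (map_mono_of_nonneg (fun x hx => (hD x hx).1) r1).trans hDp
    rw [map_sub, map_smul, map_smul, sub_le_iff_le_add] at d1
    have d2 := d1.trans (add_le_add_right (smul_le_smul_of_nonneg_left (hD q hq0).2
      (inv_nonneg.2 hc.le)) p)
    rw [smul_le_iff_le_inv_smul hc, smul_add, smul_smul] at d2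
    rw [sub_le_iff_le_add] at r2 ⊢
    refine d2.trans ((add_le_add_left r2 _).trans_eq ?_)
    module
  set K : ℝ := (√(η / 2))⁻¹ + (√(η / 2))⁻¹ * (√(η / 2))⁻¹ with hK
  have hs : 0 < √(η / 2) := Real.sqrt_pos.2 (by positivity)
  have hK0 : 0 < K := by positivity
  have far : ∀ a : ℝ, D e - r ≤ K • |p - a • e| := fun a => by
    rcases le_total a (η / 2) with ha | ha
    · have h1 : (η / 2) • e ≤ |p - a • e| := by
        refine le_trans ?_ (le_abs_self _)
        rw [le_sub_iff_add_le, ← add_smul]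
        exact (rsmul_le he (by linarith)).trans hηp
      have h2 : e ≤ (η / 2)⁻¹ • |p - a • e| := (smul_le_iff_le_inv_smul (by positivity)).1 h1
      refine (sub_le_self _ (unitSqrt_nonneg he hp)).trans
        ((hD e he).2.trans (h2.trans (rsmul_le (abs_nonneg _) ?_)))
      rw [hK, ← mul_inv, Real.mul_self_sqrt (by positivity)]
      exact le_add_of_nonneg_left (by positivity)
    · have ha0 : 0 < a := lt_of_lt_of_le (by positivity) ha
      have h1 := near (√a) (Real.sqrt_pos.2 ha0)
      rw [Real.mul_self_sqrt ha0.le] at h1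
      have h2 : √(η / 2) ≤ √a := Real.sqrt_le_sqrt ha
      refine h1.trans (rsmul_le (abs_nonneg _) ?_)
      rw [hK]
      gcongr
  have h3 := le_zero_of_le_abs_sub he hpe (g := K⁻¹ • (D e - r)) fun a => by
    rw [smul_le_iff_le_inv_smul (inv_pos.2 hK0), inv_inv]
    exact far a
  rw [smul_le_iff_le_inv_smul (inv_pos.2 hK0), smul_zero] at h3
  exact sub_nonpos.1 h3

end UnitSqrt

theorem average_apply (R : ℕ → E →ₗ[ℝ] E) (n : ℕ) (x : E) :
    ((n : ℝ)⁻¹ • ∑ k ∈ Finset.range n, R k) x = (n : ℝ)⁻¹ • ∑ k ∈ Finset.range n, R k x := by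
  rw [LinearMap.smul_apply, LinearMap.sum_apply]

/-- The Koopman–von Neumann lemma. If the averages of `a` are at most `p n`, which decreases to
`0`, then `R n` projects onto the part where `a n ≥ √(p n)`: off this part `a n` is small, and by
Chebyshev's inequality the averages of the `R k e` with `k < n` are at most
`p n / √(p n) = √(p n)`, because `√(p k) ≥ √(p n)`. -/
theorem exists_densityZero_of_average {e : E} (he : IsWeakOrderUnit e) {a : ℕ → E}
    (ha : ∀ n, 0 ≤ a n) {C : ℝ} (hC : 0 ≤ C) (haC : ∀ n, a n ≤ C • e)
    (hav : OrderTendsto (fun n : ℕ => (n : ℝ)⁻¹ • ∑ k ∈ Finset.range n, a k) 0) :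
    ∃ R : ℕ → E →ₗ[ℝ] E, (∀ n, IsBandProjection (R n)) ∧ IsDensityZero R ∧
      OrderTendsto (fun n : ℕ => (LinearMap.id - R n : E →ₗ[ℝ] E) (a n)) 0 := by
  obtain ⟨p₀, hp₀, hp₀0, h₀⟩ := hav
  have hCe : 0 ≤ C • e := smul_nonneg hC he.1
  -- truncation makes `p n` bounded, and the second summand keeps it away from `0`
  set p : ℕ → E := fun n => p₀ n ⊓ C • e + ((n : ℝ) + 1)⁻¹ • e with hp_def
  have hinf : Antitone fun n => p₀ n ⊓ C • e := fun m n hmn => inf_le_inf_right _ (hp₀ hmn)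
  have hinf0 : ∀ n, 0 ≤ p₀ n ⊓ C • e := fun n => le_inf (hp₀0.1 ⟨n, rfl⟩) hCe
  have hp : Antitone p := hinf.add (antitone_inv_smul he.1)
  have hp0 : IsGLB (Set.range p) 0 :=
    isGLB_range_add hinf (antitone_inv_smul he.1)
      ⟨by rintro _ ⟨n, rfl⟩; exact hinf0 n, fun w hw => hp₀0.2 (by
        rintro _ ⟨n, rfl⟩; exact (hw ⟨n, rfl⟩).trans inf_le_left)⟩
      (isGLB_range_inv_smul he.1)
  have hpn : ∀ n, 0 ≤ p n := fun n => hp0.1 ⟨n, rfl⟩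
  have hpe : ∀ n, p n ∈ eBounded e := fun n =>
    eBounded_add ⟨C, hC, by rw [abs_of_nonneg (hinf0 n)]; exact inf_le_right⟩
      (eBounded_smul _ (eBounded_unit he.1))
  have hη : ∀ n : ℕ, ((n : ℝ) + 1)⁻¹ • e ≤ p n := fun n => le_add_of_nonneg_left (hinf0 n)
  have hap : ∀ n : ℕ, (n : ℝ)⁻¹ • ∑ k ∈ Finset.range n, a k ≤ p n := fun n => by
    have h1 := h₀ n
    rw [sub_zero] at h1
    exact (le_inf ((le_abs_self _).trans h1) (inv_smul_sum_le hCe haC n)).trans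
      (le_add_of_nonneg_right (smul_nonneg (by positivity) he.1))
  set r : ℕ → E := fun n => unitSqrt e (p n) with hr_def
  have hr : Antitone r := fun m n hmn => unitSqrt_mono he.1 (hpn n) (hp hmn)
  have hr0 : IsGLB (Set.range r) 0 := isGLB_unitSqrt he.1 hp0
  have hR : ∀ n, IsBandProjection (nonnegProj (a n - r n)) := fun n =>
    isBandProjection_nonnegProj _
  refine ⟨fun n => nonnegProj (a n - r n), hR, ?_, ?_⟩
  · have hD : ∀ (n : ℕ) x, 0 ≤ x →
        0 ≤ ((n : ℝ)⁻¹ • ∑ k ∈ Finset.range n, nonnegProj (a k - r k)) x ∧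
        ((n : ℝ)⁻¹ • ∑ k ∈ Finset.range n, nonnegProj (a k - r k)) x ≤ x := fun n x hx => by
      rw [average_apply]
      exact ⟨inv_smul_sum_nonneg (fun k => (hR k).nonneg hx) n,
        inv_smul_sum_le hx (fun k => (hR k).le_self hx) n⟩
    refine he.opOrderTendstoZero hD hr hr0 fun n => ?_
    refine map_unit_le_unitSqrt he.1 (hD n) (by positivity) (hη n) (hpe n) ?_
    refine le_trans ?_ (hap n)
    rw [average_apply]
    refine smul_le_smul_of_nonneg_left (Finset.sum_le_sum fun k hk => ?_) (by positivity)
    exact ((hR k).mono (hr (Finset.mem_range.1 hk).le)).trans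
      ((nonnegProj_sub_le _ _).trans ((hR k).le_self (ha k)))
  · refine (orderTendsto_zero_of_antitone hr hr0).of_le (fun n => ?_) fun n => ?_
    · simpa using (hR n).le_self (ha n)
    · exact (sub_nonnegProj_sub_le (a n) (r n)).trans
        (sub_le_self _ ((hR n).nonneg (hr0.1 ⟨n, rfl⟩)))

/-- The converse part of the Koopman–von Neumann lemma: a bounded sequence that is order null off
a sequence of band projections of density zero has order null averages. -/
theorem average_of_densityZero {e : E} (he : 0 ≤ e) {a : ℕ → E} (ha : ∀ n, 0 ≤ a n) {C : ℝ}
    (hC : 0 ≤ C) (haC : ∀ n, a n ≤ C • e) {R : ℕ → E →ₗ[ℝ] E} (hR : ∀ n, IsBandProjection (R n))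
    (hR0 : IsDensityZero R)
    (hRa : OrderTendsto (fun n : ℕ => (LinearMap.id - R n : E →ₗ[ℝ] E) (a n)) 0) :
    OrderTendsto (fun n : ℕ => (n : ℝ)⁻¹ • ∑ k ∈ Finset.range n, a k) 0 := by
  have h1 := OrderTendsto.average (fun n => by simpa using (hR n).le_self (ha n)) hRa
  have h2 := OpOrderTendstoZero.apply hR0 (smul_nonneg hC he)
  refine (h2.add h1).of_le (inv_smul_sum_nonneg ha) fun n => ?_
  rw [average_apply, ← inv_smul_sum_add]
  refine inv_smul_sum_mono (fun k => ?_) n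
  rw [LinearMap.sub_apply, LinearMap.id_apply, ← sub_le_iff_le_add, sub_sub_cancel]
  exact (hR k).mono (haC k)

/-! ### Approximation by components of the unit -/

/-- Freudenthal's spectral theorem with dyadic error: the components `P e` of `e` span a dense
subspace of `E_e`. If `|f| ≤ κ e` and `P` projects onto the part where `f ≥ 0`, then
`f - (κ / 2) (2 P e - e)` is bounded by `(κ / 2) e`. -/
theorem exists_step_approximation {e : E} {M : Submodule ℝ E}
    (hM : ∀ P : E →ₗ[ℝ] E, IsBandProjection P → P e ∈ M) {f : E} {κ : ℝ} (hf : |f| ≤ κ • e)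
    (m : ℕ) : ∃ s ∈ M, |f - s| ≤ ((1 / 2 : ℝ) ^ m * κ) • e := by
  induction m with
  | zero => exact ⟨0, M.zero_mem, by simpa using hf⟩
  | succ m ih =>
    obtain ⟨s, hs, hfs⟩ := ih
    set c : ℝ := (1 / 2 : ℝ) ^ m * κ with hc
    set g := f - s with hg
    have hP := isBandProjection_nonnegProj g
    have hPg := nonnegProj_self g
    set P := nonnegProj g with hPdef
    have h1 : g ≤ c • P e := by
      refine (le_posPart g).trans ?_
      rw [← hPg, ← map_smul]
      exact hP.mono ((le_abs_self g).trans hfs)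
    have h2 : -g ≤ c • (e - P e) := by
      have h3 : -g - P (-g) ≤ c • e - P (c • e) := hP.sub_mono ((neg_le_abs g).trans hfs)
      rw [map_smul, ← smul_sub, map_neg, hPg, sub_neg_eq_add] at h3
      exact (le_add_of_nonneg_right (posPart_nonneg g)).trans h3
    refine ⟨s + (c / 2) • ((2 : ℝ) • P e - e), M.add_mem hs (M.smul_mem _
      (M.sub_mem (M.smul_mem _ (hM P hP)) (hM _ IsBandProjection.linearMap_id))), ?_⟩
    have h4 : (1 / 2 : ℝ) ^ (m + 1) * κ = c / 2 := by rw [hc]; ring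
    rw [h4, ← sub_sub, ← hg]
    refine abs_le'.2 ⟨?_, ?_⟩
    · rw [sub_le_iff_le_add]
      exact h1.trans_eq (by module)
    · rw [neg_sub, sub_eq_add_neg, ← le_sub_iff_add_le']
      exact h2.trans_eq (by module)

/-- For a sequence of uniformly bounded operators on `E_e`, order convergence of the averages of
absolute values to `0` passes from components of `e` to all of `E_e`. -/
theorem average_of_components {e : E} (he : 0 ≤ e) {Ψ : ℕ → E → E} {c : ℝ} (hc : 0 ≤ c)
    (hadd : ∀ k, ∀ f ∈ eBounded e, ∀ g ∈ eBounded e, Ψ k (f + g) = Ψ k f + Ψ k g)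
    (hsmul : ∀ k (a : ℝ), ∀ f ∈ eBounded e, Ψ k (a • f) = a • Ψ k f)
    (hbd : ∀ k f (κ : ℝ), 0 ≤ κ → |f| ≤ κ • e → |Ψ k f| ≤ (c * κ) • e)
    (hP : ∀ P : E →ₗ[ℝ] E, IsBandProjection P →
      OrderTendsto (fun n : ℕ => (n : ℝ)⁻¹ • ∑ k ∈ Finset.range n, |Ψ k (P e)|) 0)
    {f : E} (hf : f ∈ eBounded e) :
    OrderTendsto (fun n : ℕ => (n : ℝ)⁻¹ • ∑ k ∈ Finset.range n, |Ψ k f|) 0 := by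
  have avg_nonneg : ∀ (g : E) (n : ℕ), 0 ≤ (n : ℝ)⁻¹ • ∑ k ∈ Finset.range n, |Ψ k g| :=
    fun g => inv_smul_sum_nonneg fun _ => abs_nonneg _
  have h0 : (0 : E) ∈ eBounded e := ⟨0, le_rfl, by simp⟩
  have hΨ0 : ∀ k, Ψ k 0 = 0 := fun k => by simpa using hsmul k 0 0 h0
  let M : Submodule ℝ E :=
    { carrier := {g | g ∈ eBounded e ∧
        OrderTendsto (fun n : ℕ => (n : ℝ)⁻¹ • ∑ k ∈ Finset.range n, |Ψ k g|) 0}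
      zero_mem' := ⟨h0, (hP _ IsBandProjection.linearMap_id).of_le (avg_nonneg 0) fun n =>
        inv_smul_sum_mono (fun k => by rw [hΨ0, abs_zero]; exact abs_nonneg _) n⟩
      add_mem' := by
        rintro g h ⟨hg, hg'⟩ ⟨hh, hh'⟩
        refine ⟨eBounded_add hg hh, (hg'.add hh').of_le (avg_nonneg _) fun n => ?_⟩
        rw [← inv_smul_sum_add]
        exact inv_smul_sum_mono (fun k => by rw [hadd k g hg h hh]; exact abs_add_le _ _) n
      smul_mem' := by
        rintro a g ⟨hg, hg'⟩
        refine ⟨eBounded_smul a hg, (hg'.smul |a|).of_le (avg_nonneg _) fun n => ?_⟩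
        rw [smul_comm |a| (n : ℝ)⁻¹, Finset.smul_sum (r := |a|)]
        exact inv_smul_sum_mono (fun k => by rw [hsmul k a g hg]; exact abs_smul_eq a _) n }
  have hPM : ∀ P : E →ₗ[ℝ] E, IsBandProjection P → P e ∈ M := fun P hPb =>
    ⟨⟨1, zero_le_one, by
      rw [abs_of_nonneg (hPb.nonneg he), one_smul]; exact hPb.le_self he⟩, hP P hPb⟩
  obtain ⟨κ, hκ, hfκ⟩ := id hf
  choose s hsM hfs using exists_step_approximation hPM hfκ
  refine orderTendsto_zero_of_le_add (avg_nonneg f) (fun m => (hsM m).2)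
    (z := fun m => (c * ((1 / 2 : ℝ) ^ m * κ)) • e) (fun m n => ?_) fun w hw => ?_
  · have h1 : ∀ k, |Ψ k f| ≤ |Ψ k (s m)| + (c * ((1 / 2 : ℝ) ^ m * κ)) • e := fun k => by
      have h2 : Ψ k f = Ψ k (s m) + Ψ k (f - s m) := by
        rw [← hadd k _ (hsM m).1 _ (eBounded_sub hf (hsM m).1), add_sub_cancel]
      rw [h2]
      exact (abs_add_le _ _).trans
        (add_le_add_right (hbd k _ _ (by positivity) (hfs m)) _)
    refine (inv_smul_sum_mono h1 n).trans ?_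
    rw [inv_smul_sum_add]
    exact add_le_add_right (inv_smul_sum_le (smul_nonneg (by positivity) he)
      (fun _ => le_rfl) n) _
  · refine le_zero_of_le_smul (u := (c * κ) • e) fun ε hε => ?_
    obtain ⟨m, hm⟩ := exists_pow_lt_of_lt_one hε (by norm_num : (1 / 2 : ℝ) < 1)
    refine (hw m).trans ?_
    rw [smul_smul]
    refine rsmul_le he ?_
    have : 0 ≤ c * κ := by positivity
    nlinarith

/-! ### Correlations -/

/-- The `k`-th correlation `T ((S ^ k f) · g) - T f · T g` of `f` and `g`. -/
noncomputable def correlation (T S : E →ₗ[ℝ] E) (e : E) (k : ℕ) (f g : E) : E :=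
  T (eMul e ((S ^ k) f) g) - eMul e (T f) (T g)

theorem eMul_add_right {e f g h : E} (he : 0 ≤ e) (hf : f ∈ eBounded e) (hg : g ∈ eBounded e)
    (hh : h ∈ eBounded e) : eMul e h (f + g) = eMul e h f + eMul e h g := by
  rw [eMul_comm he hh (eBounded_add hf hg), eMul_add_left he hf hg hh, eMul_comm he hf hh,
    eMul_comm he hg hh]

theorem eMul_smul_right {e f g : E} (he : 0 ≤ e) (a : ℝ) (hf : f ∈ eBounded e)
    (hg : g ∈ eBounded e) : eMul e f (a • g) = a • eMul e f g := by
  rw [eMul_comm he hf (eBounded_smul a hg), eMul_smul_left he a hg hf, eMul_comm he hg hf]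

theorem abs_map_le_smul_unit {A : E →ₗ[ℝ] E} {e f : E} (hA : ∀ x, 0 ≤ x → 0 ≤ A x) (hAe : A e = e)
    {κ : ℝ} (hf : |f| ≤ κ • e) : |A f| ≤ κ • e := by
  have := map_mono_of_nonneg hA hf
  rw [map_smul, hAe] at this
  exact (abs_map_le_map_abs hA f).trans this

theorem eBounded_map {A : E →ₗ[ℝ] E} {e f : E} (hA : ∀ x, 0 ≤ x → 0 ≤ A x) (hAe : A e = e)
    (hf : f ∈ eBounded e) : A f ∈ eBounded e := by
  obtain ⟨κ, hκ, hf⟩ := hf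
  exact ⟨κ, hκ, abs_map_le_smul_unit hA hAe hf⟩

theorem abs_eMul_le_smul_unit {e f g : E} (he : 0 ≤ e) {κ l : ℝ} (hκ : 0 ≤ κ) (hl : 0 ≤ l)
    (hf : |f| ≤ κ • e) (hg : |g| ≤ l • e) : |eMul e f g| ≤ (l * κ) • e := by
  rw [mul_smul]
  exact (abs_eMul_le he ⟨κ, hκ, hf⟩ hl hg).trans (smul_le_smul_of_nonneg_left hf hl)

namespace IsConditionalExpectationPreservingSystem

variable {T S : E →ₗ[ℝ] E} {e : E}

theorem pow_nonneg (h : IsConditionalExpectationPreservingSystem T S e) (k : ℕ) {x : E}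
    (hx : 0 ≤ x) : 0 ≤ (S ^ k) x := by
  induction k with
  | zero => simpa using hx
  | succ k ih =>
    rw [pow_succ', Module.End.mul_apply]
    have h1 := h.S_sup ((S ^ k) x) 0
    rw [sup_of_le_left ih, map_zero] at h1
    rw [h1]
    exact le_sup_right

theorem pow_unit (h : IsConditionalExpectationPreservingSystem T S e) (k : ℕ) :
    (S ^ k) e = e := by
  induction k with
  | zero => simp
  | succ k ih => rw [pow_succ, Module.End.mul_apply, h.S_unit, ih]

variable {f f' g g' : E}

theorem eBounded_pow (h : IsConditionalExpectationPreservingSystem T S e) (k : ℕ)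
    (hf : f ∈ eBounded e) : (S ^ k) f ∈ eBounded e :=
  eBounded_map (fun _ => h.pow_nonneg k) (h.pow_unit k) hf

theorem eBounded_condExp (h : IsConditionalExpectationPreservingSystem T S e)
    (hf : f ∈ eBounded e) : T f ∈ eBounded e :=
  eBounded_map h.condExp.positive h.T_unit hf

theorem eBounded_component (h : IsConditionalExpectationPreservingSystem T S e) {P : E →ₗ[ℝ] E}
    (hP : IsBandProjection P) : P e ∈ eBounded e :=
  ⟨1, zero_le_one, by
    rw [abs_of_nonneg (hP.nonneg h.unit.1), one_smul]; exact hP.le_self h.unit.1⟩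

theorem correlation_add_left (h : IsConditionalExpectationPreservingSystem T S e) (k : ℕ)
    (hf : f ∈ eBounded e) (hf' : f' ∈ eBounded e) (hg : g ∈ eBounded e) :
    correlation T S e k (f + f') g = correlation T S e k f g + correlation T S e k f' g := by
  simp only [correlation, map_add]
  rw [eMul_add_left h.unit.1 (h.eBounded_pow k hf) (h.eBounded_pow k hf') hg,
    eMul_add_left h.unit.1 (h.eBounded_condExp hf) (h.eBounded_condExp hf')
      (h.eBounded_condExp hg), map_add]
  abel

theorem correlation_add_right (h : IsConditionalExpectationPreservingSystem T S e) (k : ℕ)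
    (hf : f ∈ eBounded e) (hg : g ∈ eBounded e) (hg' : g' ∈ eBounded e) :
    correlation T S e k f (g + g') = correlation T S e k f g + correlation T S e k f g' := by
  simp only [correlation, map_add]
  rw [eMul_add_right h.unit.1 hg hg' (h.eBounded_pow k hf),
    eMul_add_right h.unit.1 (h.eBounded_condExp hg) (h.eBounded_condExp hg')
      (h.eBounded_condExp hf), map_add]
  abel

theorem correlation_smul_left (h : IsConditionalExpectationPreservingSystem T S e) (k : ℕ) (a : ℝ)
    (hf : f ∈ eBounded e) (hg : g ∈ eBounded e) :
    correlation T S e k (a • f) g = a • correlation T S e k f g := by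
  simp only [correlation, map_smul]
  rw [eMul_smul_left h.unit.1 a (h.eBounded_pow k hf) hg,
    eMul_smul_left h.unit.1 a (h.eBounded_condExp hf) (h.eBounded_condExp hg), map_smul, smul_sub]

theorem correlation_smul_right (h : IsConditionalExpectationPreservingSystem T S e) (k : ℕ)
    (a : ℝ) (hf : f ∈ eBounded e) (hg : g ∈ eBounded e) :
    correlation T S e k f (a • g) = a • correlation T S e k f g := by
  simp only [correlation, map_smul]
  rw [eMul_smul_right h.unit.1 a (h.eBounded_pow k hf) hg,
    eMul_smul_right h.unit.1 a (h.eBounded_condExp hf) (h.eBounded_condExp hg), map_smul, smul_sub]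

theorem abs_correlation_le (h : IsConditionalExpectationPreservingSystem T S e) (k : ℕ) {κ l : ℝ}
    (hκ : 0 ≤ κ) (hl : 0 ≤ l) (hf : |f| ≤ κ • e) (hg : |g| ≤ l • e) :
    |correlation T S e k f g| ≤ (2 * l * κ) • e := by
  have hT := h.condExp.positive
  have h1 := abs_map_le_smul_unit hT h.T_unit (abs_eMul_le_smul_unit h.unit.1 hκ hl
    (abs_map_le_smul_unit (fun _ => h.pow_nonneg k) (h.pow_unit k) hf) hg)
  have h2 := abs_eMul_le_smul_unit h.unit.1 hκ hl (abs_map_le_smul_unit hT h.T_unit hf)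
    (abs_map_le_smul_unit hT h.T_unit hg)
  rw [correlation, sub_eq_add_neg]
  refine (abs_add_le _ _).trans ?_
  rw [abs_neg]
  exact (add_le_add h1 h2).trans_eq (by module)

/-- Weak mixing on components extends to `E_e`, one variable at a time. -/
theorem average_correlation (h : IsConditionalExpectationPreservingSystem T S e)
    (hmix : ∀ P Q : E →ₗ[ℝ] E, IsBandProjection P → IsBandProjection Q →
      OrderTendsto (fun n : ℕ => (n : ℝ)⁻¹ • ∑ k ∈ Finset.range n,
        |correlation T S e k (P e) (Q e)|) 0)
    (hf : f ∈ eBounded e) (hg : g ∈ eBounded e) :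
    OrderTendsto (fun n : ℕ => (n : ℝ)⁻¹ • ∑ k ∈ Finset.range n, |correlation T S e k f g|) 0 := by
  have left : ∀ Q : E →ₗ[ℝ] E, IsBandProjection Q → OrderTendsto (fun n : ℕ =>
      (n : ℝ)⁻¹ • ∑ k ∈ Finset.range n, |correlation T S e k f (Q e)|) 0 := fun Q hQ => by
    have hQe := h.eBounded_component hQ
    obtain ⟨l, hl, hQl⟩ := id hQe
    exact average_of_components h.unit.1 (Ψ := fun k f => correlation T S e k f (Q e))
      (c := 2 * l) (by positivity) (fun k _ hx _ hy => h.correlation_add_left k hx hy hQe)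
      (fun k a _ hx => h.correlation_smul_left k a hx hQe)
      (fun k _ _ hκ hx => h.abs_correlation_le k hκ hl hx hQl) (fun P hP => hmix P Q hP hQ) hf
  obtain ⟨κ, hκ, hfκ⟩ := id hf
  refine average_of_components h.unit.1 (Ψ := fun k g => correlation T S e k f g)
    (c := 2 * κ) (by positivity) (fun k _ hx _ hy => h.correlation_add_right k hf hx hy)
    (fun k a _ hx => h.correlation_smul_right k a hf hx)
    (fun k _ l hl hx => (h.abs_correlation_le k hκ hl hfκ hx).trans_eq (by ring_nf)) left hg

end IsConditionalExpectationPreservingSystem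

end RieszMixing

theorem theorem4p4 {E : Type*} [AddCommGroup E] [ConditionallyCompleteLattice E]
    [IsOrderedAddMonoid E] [Module ℝ E] [PosSMulMono ℝ E]
    (T S : E →ₗ[ℝ] E) (e : E)
    (h : RieszMixing.IsConditionalExpectationPreservingSystem T S e) :
    List.TFAE [
      RieszMixing.IsWeaklyMixing T S e,
      ∀ f ∈ RieszMixing.eBounded e, ∀ g ∈ RieszMixing.eBounded e,
        RieszMixing.OrderTendsto (fun n : ℕ => (n : ℝ)⁻¹ • ∑ k ∈ Finset.range n,
          |T (RieszMixing.eMul e ((S ^ k) f) g) - RieszMixing.eMul e (T f) (T g)|) 0,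
      ∀ P Q : E →ₗ[ℝ] E, RieszMixing.IsBandProjection P → RieszMixing.IsBandProjection Q →
        ∃ R : ℕ → E →ₗ[ℝ] E, (∀ n, RieszMixing.IsBandProjection (R n)) ∧
          RieszMixing.IsDensityZero R ∧
          RieszMixing.OrderTendsto (fun n : ℕ => (LinearMap.id - R n : E →ₗ[ℝ] E)
            |T (RieszMixing.eMul e ((S ^ n) (P e)) (Q e))
              - RieszMixing.eMul e (T (P e)) (T (Q e))|) 0] := by
  have bound : ∀ P Q : E →ₗ[ℝ] E, RieszMixing.IsBandProjection P →
      RieszMixing.IsBandProjection Q → ∃ C : ℝ, 0 ≤ C ∧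
        ∀ n, |RieszMixing.correlation T S e n (P e) (Q e)| ≤ C • e := fun P Q hP hQ => by
    obtain ⟨κ, hκ, hPκ⟩ := h.eBounded_component hP
    obtain ⟨l, hl, hQl⟩ := h.eBounded_component hQ
    exact ⟨2 * l * κ, by positivity, fun n => h.abs_correlation_le n hκ hl hPκ hQl⟩
  tfae_have 1 → 2 := fun hmix f hf g hg => h.average_correlation hmix hf hg
  tfae_have 2 → 1 := fun h2 P Q hP hQ =>
    h2 _ (h.eBounded_component hP) _ (h.eBounded_component hQ)
  tfae_have 1 → 3 := fun hmix P Q hP hQ => by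
    obtain ⟨C, hC, hb⟩ := bound P Q hP hQ
    exact RieszMixing.exists_densityZero_of_average h.unit (fun _ => abs_nonneg _) hC hb
      (hmix P Q hP hQ)
  tfae_have 3 → 1 := fun h3 P Q hP hQ => by
    obtain ⟨C, hC, hb⟩ := bound P Q hP hQ
    obtain ⟨R, hR, hR0, hRa⟩ := h3 P Q hP hQ
    exact RieszMixing.average_of_densityZero h.unit.1 (fun _ => abs_nonneg _) hC hb hR hR0 hRa
  tfae_finish
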